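/- **Proposition 4.** Let $\ell\ge 1$ and $n=2\ell+1$. Let $\Gamma^1,\dots,\Gamma^{n}$ be the $2^\ell\times 2^\ell$ Clifford matrices, defined recursively: for $\ell=1$ they are the Pauli matrices $X,Y,Z$, and from the matrices $\Gamma'^i$ for $\ell-1$ one gets $\Gamma^i=X\otimes\Gamma'^i$ ($i\le 2\ell-1$), $\Gamma^{2\ell}=Y\otimes 1$, $\Gamma^{2\ell+1}=Z\otimes 1$. Put $\Gamma^{ab}=[\Gamma^a,\Gamma^b]/2i$ for $a\ne b$, let $\mathcal S$ be the group generated by all $e^{-i\theta\Gamma^{ab}}$ ($\theta\in\mathbb R$), and say that an operator $V$ on $\mathbb C^{2^\ell}$ covers a real $n\times n$ matrix $R$ if $V^\dagger\Gamma^iV=\sum_jR_{ij}\Gamma^j$ for all $i$. A byproduct is a (possibly empty) product of matrices $\Gamma^a$. The $SO(n)$ AKLT state with on-site fundamental irrep (dimension $n$) and virtual spinor irrep (dimension $2^\ell$) is the matrix product state of $N$ spins with Kraus operators $A_a=\Gamma^a/\sqrt n$: jointly with the virtual system (correlator), initially in the state $|L\rangle$, it is $\sum_{i_1,\dots,i_N}|i_1\dots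 i_N\rangle\otimes A_{i_1}\cdots A_{i_N}|L\rangle$. The spins are measured one after another (site $N$ first, site $1$ last) in orthonormal bases with bras $\langle w_j|=\sum_i W_{ji}\langle i|$, $W$ unitary, where $W$ may depend on the earlier outcomes; outcomes have Born probabilities. Then: 1. *(The state.)* A family $(A_a)_{a=1}^n$ of operators on $\mathbb C^{2^\ell}$ satisfies $\sum_aA_a^\dagger A_a=1$ and the symmetry condition $\sum_jR_{ij}A_j=V^\dagger A_iV$ for all $i$, all $R\in SO(n)$ and all $V\in\mathcal S$ covering $R$, if and only if $A_a=z\,\Gamma^a/\sqrt n$ for all $a$ with one phase $z$. 2. *(Byproducts.)* Each $\Gamma^a$ is a tensor product of $\ell$ matrices from $\{1,X,Y,Z\}$, and each byproduct is such a tensor product times a fourth root of unity. 3. *(Gates.)* Let $G$ be the set of unitaries $U$ on $\mathbb C^{2^\ell}$ such that, for some $N$, some measurement as above and some sequence of outcomes, the correlator goes from $|L\rangle$ to $cU|L\rangle$ for all $|L\rangle$, with a constant $c\neq0$. Then $G$ is a group, and there is a surjective homomorphism $\pi:G\to SO(n)$, with kernel exactly the global phases, such that each $U\in G$ covers $\pi(U)$;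 so the induced gates form $SO(n)$. In spinor form: $\mathcal S\subseteq G$; each $R\in SO(n)$ equals $\pi(V)$ for some $V=\prod_{a<b}e^{-i\theta_{ab}\Gamma^{ab}}$ (pairs in lexicographic order), and each $U\in G$ is a phase times such a product. 4. *(Measurement bases.)* For $V\in\mathcal S$ the matrix $u_{ij}(V)=\mathrm{tr}(\Gamma^iV\Gamma^jV^\dagger)/2^\ell$ is the matrix in $SO(n)$ covered by $V$. Measuring $N$ spins in the bases $u(V_k)$, with $V_k\in\mathcal S$ for site $k$ (possibly depending on the earlier outcomes), and obtaining the outcomes $j_1,\dots,j_N$ takes $|L\rangle$ to $n^{-N/2}\prod_{k=1}^N(V_k^\dagger\Gamma^{j_k}V_k)|L\rangle$ (factors ordered from left to right), and this has probability $n^{-N}$ for every normalized $|L\rangle$. 5. *(Success probability.)* Let $B$ be a byproduct that has accumulated so far and let $a\ne b$. There is $\varepsilon\in\{1,-1\}$ such that for all $\varphi\in\mathbb R$: $Be^{-i\varphi\Gamma^{ab}}=e^{-i\varepsilon\varphi\Gamma^{ab}}B$; and if the next spin is measured in the basis $u(e^{-i(\varepsilon\varphi/2)\Gamma^{ab}})$,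 then, up to nonzero scalars, for all virtual states $\psi$, an outcome $j\in\{a,b\}$ takes $B\psi$ to $\Gamma^jB\,e^{-i\varphi\Gamma^{ab}}\psi$ (the gate is performed, the new byproduct being $\Gamma^jB$), and an outcome $j\notin\{a,b\}$ takes $B\psi$ to $\Gamma^jB\psi$ (the identity is performed). If $\sin\varphi\ne0$ (nontrivial gate), then for every normalized state of the correlator the probability of an outcome $j$ that performs $e^{-i\varphi\Gamma^{ab}}$ in this sense is $2/(2\ell+1)$, and the probability of an outcome that performs the identity is $1-2/(2\ell+1)$. -/

import Mathlib

open Matrix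
open scoped Kronecker

noncomputable section

namespace SOAKLT

/-- The identity and the three Pauli matrices `X, Y, Z`. -/
def pauli : Fin 4 → Matrix (Fin 2) (Fin 2) ℂ :=
  ![1, !![0, 1; 1, 0], !![0, -Complex.I; Complex.I, 0], !![1, 0; 0, -1]]

/-- Index set of the standard basis of the space of `ℓ` qubits (the virtual space). -/
def QIdx : ℕ → Type
  | 0 => Unit
  | ℓ + 1 => Fin 2 × QIdx ℓ

instance instFintypeQIdx : (ℓ : ℕ) → Fintype (QIdx ℓ)
  | 0 => inferInstanceAs (Fintype Unit)
  | ℓ + 1 => @instFintypeProd (Fin 2) (QIdx ℓ) _ (instFintypeQIdx ℓ)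

instance instDecidableEqQIdx : (ℓ : ℕ) → DecidableEq (QIdx ℓ)
  | 0 => inferInstanceAs (DecidableEq Unit)
  | ℓ + 1 => @instDecidableEqProd (Fin 2) (QIdx ℓ) _ (instDecidableEqQIdx ℓ)

/-- The virtual space has dimension `2 ^ ℓ`. -/
theorem card_qIdx : (ℓ : ℕ) → Fintype.card (QIdx ℓ) = 2 ^ ℓ
  | 0 => rfl
  | ℓ + 1 => by
    have h : Fintype.card (QIdx (ℓ + 1)) = Fintype.card (Fin 2) * Fintype.card (QIdx ℓ) :=
      Fintype.card_prod _ _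
    rw [h, card_qIdx ℓ, Fintype.card_fin, pow_succ, mul_comm]

/-- Operators on the virtual space. -/
abbrev VOp (ℓ : ℕ) : Type := Matrix (QIdx ℓ) (QIdx ℓ) ℂ

/-- The on-site index set `{1, …, 2ℓ+1}` (shifted to start at `0`). -/
abbrev Site (ℓ : ℕ) : Type := Fin (2 * ℓ + 1)

/-- The tensor product `pauli (p 0) ⊗ ⋯ ⊗ pauli (p (ℓ-1))`. -/
def pauliString : (ℓ : ℕ) → (Fin ℓ → Fin 4) → VOp ℓ
  | 0, _ => (1 : Matrix Unit Unit ℂ)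
  | ℓ + 1, p => pauli (p 0) ⊗ₖ pauliString ℓ (Fin.tail p)

/-- The Clifford matrices `Γ^a`, by recursion on `ℓ`: the old ones are tensored with `X` on the
left, and the two last ones are `Y ⊗ 1` and `Z ⊗ 1`. Starting the recursion from the `1 × 1`
matrix `1` gives `X, Y, Z` at `ℓ = 1`. -/
def Γ : (ℓ : ℕ) → Site ℓ → VOp ℓ
  | 0 => fun _ => (1 : Matrix Unit Unit ℂ)
  | ℓ + 1 =>
    Fin.snoc (n := 2 * ℓ + 2) (α := fun _ => VOp (ℓ + 1))
      (Fin.snoc (n := 2 * ℓ + 1) (α := fun _ => VOp (ℓ + 1))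
        (fun i => pauli 1 ⊗ₖ Γ ℓ i) (pauli 2 ⊗ₖ (1 : VOp ℓ)))
      (pauli 3 ⊗ₖ (1 : VOp ℓ))

/-- The generators `Γ^{ab} = [Γ^a, Γ^b] / (2i)` of the spinor representation. -/
def gen (ℓ : ℕ) (a b : Site ℓ) : VOp ℓ :=
  (1 / (2 * Complex.I)) • (Γ ℓ a * Γ ℓ b - Γ ℓ b * Γ ℓ a)

/-- The gate `exp(-iθ Γ^{ab})`. -/
def rot (ℓ : ℕ) (a b : Site ℓ) (θ : ℝ) : VOp ℓ :=
  NormedSpace.exp ((-(Complex.I * (θ : ℂ))) • gen ℓ a b)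

/-- The product `∏_{a<b} exp(-iθ_{ab} Γ^{ab})` of `ℓ(2ℓ+1)` gates, in lexicographic order of the
pairs from left to right. -/
def spinorProd (ℓ : ℕ) (θ : Site ℓ → Site ℓ → ℝ) : VOp ℓ :=
  ((List.finRange (2 * ℓ + 1)).map fun a =>
    (((List.finRange (2 * ℓ + 1)).filter fun b => a < b).map fun b => rot ℓ a b (θ a b)).prod).prod

/-- The spinor form of the group: everything generated by the gates `exp(-iθ Γ^{ab})`.
The generating set is closed under inverses (`θ ↦ -θ`). -/
def spinGates (ℓ : ℕ) : Submonoid (VOp ℓ) :=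
  Submonoid.closure {V | ∃ a b : Site ℓ, a ≠ b ∧ ∃ θ : ℝ, V = rot ℓ a b θ}

/-- Byproduct operators: the Clifford matrices and their products. -/
def byproducts (ℓ : ℕ) : Submonoid (VOp ℓ) :=
  Submonoid.closure (Set.range (Γ ℓ))

/-- `V` acts on the Clifford matrices through the rotation `R`: `V† Γ^i V = ∑_j R_{ij} Γ^j`. -/
def Covers (ℓ : ℕ) (V : VOp ℓ) (R : Matrix (Site ℓ) (Site ℓ) ℝ) : Prop :=
  ∀ i, Vᴴ * Γ ℓ i * V = ∑ j, (R i j : ℂ) • Γ ℓ j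

/-- The defining property of an AKLT tensor with on-site fundamental and virtual spinor irrep:
trace preservation `∑ A_i† A_i = 1` and the symmetry condition
`∑_j R_{ij} A_j = V(R)† A_i V(R)`, where `V(R)` is a spinor form of `R ∈ SO(2ℓ+1)`. -/
def IsAKLTTensor (ℓ : ℕ) (A : Site ℓ → VOp ℓ) : Prop :=
  (∑ i, (A i)ᴴ * A i = 1) ∧
  ∀ R ∈ Matrix.specialOrthogonalGroup (Site ℓ) ℝ, ∀ V ∈ spinGates ℓ, Covers ℓ V R →
    ∀ i, ∑ j, (R i j : ℂ) • A j = Vᴴ * A i * V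

/-- The Kraus operators `A_a = Γ^a / √(2ℓ+1)` of the AKLT state. -/
def kraus (ℓ : ℕ) (a : Site ℓ) : VOp ℓ :=
  (((Real.sqrt (2 * ℓ + 1))⁻¹ : ℝ) : ℂ) • Γ ℓ a

/-- The AKLT matrix product state of `N` spins, jointly with the correlator, for the initial
correlator state `L`: the component at `|i_1 … i_N⟩` is the correlator vector
`A_{i_1} ⋯ A_{i_N} |L⟩`. Contraction with `⟨R|` gives the amplitudes of the open chain. -/
def akltState (ℓ N : ℕ) (L : QIdx ℓ → ℂ) (i : Fin N → Site ℓ) : QIdx ℓ → ℂ :=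
  (List.ofFn fun k => kraus ℓ (i k)).prod *ᵥ L

/-- The outcomes obtained before site `k` is measured (latest first): site `N`, whose Kraus
operator acts first on the correlator, is measured first. -/
def history {ℓ N : ℕ} (s : Fin N → Site ℓ) (k : Fin N) : List (Site ℓ) :=
  (List.ofFn s).drop (k + 1)

/-- The (unnormalized) correlator state after an adaptive projective measurement of the `N` spins
with outcomes `s`. After the outcomes `h` the next spin is measured in the orthonormal basis whose
bras are the rows `⟨w_j| = ∑_i W(h)_{ji} ⟨i|` of the unitary matrix `W h`. -/
def postState {ℓ N : ℕ} (W : List (Site ℓ) → Matrix (Site ℓ) (Site ℓ) ℂ)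
    (s : Fin N → Site ℓ) (L : QIdx ℓ → ℂ) : QIdx ℓ → ℂ :=
  ∑ i : Fin N → Site ℓ, (∏ k, W (history s k) (s k) (i k)) • akltState ℓ N L i

/-- Squared norm of a vector of the virtual space. -/
def normSq {ℓ : ℕ} (ψ : QIdx ℓ → ℂ) : ℝ := ∑ x, ‖ψ x‖ ^ 2

/-- Born probability of the outcomes `s`, for a normalized initial correlator state `L`. -/
def outcomeProb {ℓ N : ℕ} (W : List (Site ℓ) → Matrix (Site ℓ) (Site ℓ) ℂ)
    (s : Fin N → Site ℓ) (L : QIdx ℓ → ℂ) : ℝ := normSq (postState W s L)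

/-- The unitary gates on the virtual space that some outcome of nonzero probability of some
adaptive on-site projective measurement of some number of spins induces. -/
def inducedGates (ℓ : ℕ) : Set (Matrix.unitaryGroup (QIdx ℓ) ℂ) :=
  {U | ∃ (N : ℕ) (W : List (Site ℓ) → Matrix (Site ℓ) (Site ℓ) ℂ) (s : Fin N → Site ℓ) (c : ℂ),
    (∀ h, W h ∈ Matrix.unitaryGroup (Site ℓ) ℂ) ∧ c ≠ 0 ∧
    ∀ L, postState W s L = c • ((U : VOp ℓ) *ᵥ L)}

/-- The measurement basis belonging to the virtual operator `V`:
`u_{ij} = tr(Γ^i V Γ^j V†) / 2^ℓ`. -/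
def measBasis (ℓ : ℕ) (V : VOp ℓ) : Matrix (Site ℓ) (Site ℓ) ℂ :=
  Matrix.of fun i j => Matrix.trace (Γ ℓ i * V * Γ ℓ j * Vᴴ) / 2 ^ ℓ

/-- With the byproduct `B` already accumulated, the outcome `j` of measuring the next spin in the
basis `W` performs the gate `G`: up to a nonzero scalar the correlator goes from `B ψ` to
`(Γ^j B) (G ψ)`, that is, `G` is performed and the new byproduct is `Γ^j B`. -/
def Performs (ℓ : ℕ) (W : Matrix (Site ℓ) (Site ℓ) ℂ) (B G : VOp ℓ) (j : Site ℓ) : Prop :=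
  ∃ c : ℂ, c ≠ 0 ∧ ∀ ψ : QIdx ℓ → ℂ,
    postState (fun _ => W) (fun _ : Fin 1 => j) (B *ᵥ ψ) = c • ((Γ ℓ j * B * G) *ᵥ ψ)

open Classical in
/-- Probability that measuring one spin in the basis `W`, with byproduct `B` accumulated and the
correlator in the normalized state `χ`, performs the gate `G` (up to the byproduct). -/
def performProb (ℓ : ℕ) (W : Matrix (Site ℓ) (Site ℓ) ℂ) (B G : VOp ℓ) (χ : QIdx ℓ → ℂ) : ℝ :=
  ∑ j ∈ Finset.univ.filter (fun j => Performs ℓ W B G j),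
    outcomeProb (fun _ => W) (fun _ : Fin 1 => j) χ

end SOAKLT

end

open SOAKLT

/-
The exponentials `rot θ = cos θ - sin θ Γ^a Γ^b` rotate the plane `(a, b)` by `2θ` under
conjugation. Every rotation is a lexicographically ordered product of plane rotations (Givens
elimination), so the products of exponentials cover `SO(2ℓ+1)`. Since the dimension is odd, the
product of all the `Γ^a` is a scalar; hence operators commuting with the pairs `Γ^a Γ^b` commute
with every `Γ^a` and are scalars, which gives the uniqueness of the tensor, and the kernel of the
covering. Measuring a spin applies a vector `∑_j w_j Γ^j`, and conjugation by an invertible vector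
is minus a reflection, of determinant `1` in odd dimension, so that induced gates cover rotations.
Conversely `Γ^a (V† Γ^a V) = rot θ` for `V = rot (θ/2)`: bases `u(V)` induce all exponentials.
-/

namespace SOAKLT

open scoped Matrix.Module

section PlaneRotations

variable {ι : Type*} [DecidableEq ι]

/-- The rotation by the angle `t` in the coordinate plane `(a, b)`, for `a ≠ b`. -/
noncomputable def givens (a b : ι) (t : ℝ) : Matrix ι ι ℝ :=
  1 + (Real.cos t - 1) • (single a a 1 + single b b 1) + Real.sin t • (single b a 1 - single a b 1)

theorem transpose_givens (a b : ι) (t : ℝ) : (givens a b t)ᵀ = givens a b (-t) := by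
  simp only [givens, transpose_add, transpose_sub, transpose_smul, transpose_one,
    transpose_single, Real.cos_neg, Real.sin_neg]
  module

variable [Fintype ι]

theorem sum_givens_smul {M : Type*} [AddCommGroup M] [Module ℝ M] {a b : ι} (h : a ≠ b) (t : ℝ)
    (v : ι → M) (i : ι) : ∑ j, givens a b t i j • v j =
      if i = a then Real.cos t • v a - Real.sin t • v b
      else if i = b then Real.sin t • v a + Real.cos t • v b else v i := by
  have expand : givens a b t • v = v + (Real.cos t - 1) • (Pi.single a (v a) + Pi.single b (v b)) +
      Real.sin t • (Pi.single b (v a) - Pi.single a (v b)) := by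
    simp only [givens, add_smul, sub_smul, smul_assoc, one_smul, Module.single_smul]
  rw [← Module.smul_apply, expand]
  simp only [Pi.add_apply, Pi.sub_apply, Pi.smul_apply, Pi.single_apply]
  split_ifs with ha hb hb
  · exact (h (ha.symm.trans hb)).elim
  · subst ha; module
  · subst hb; module
  · module

theorem givens_mulVec_apply {a b : ι} (h : a ≠ b) (t : ℝ) (v : ι → ℝ) (i : ι) :
    (givens a b t *ᵥ v) i =
      if i = a then Real.cos t * v a - Real.sin t * v b
      else if i = b then Real.sin t * v a + Real.cos t * v b else v i :=
  sum_givens_smul h t v i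

theorem givens_mulVec_single_of_ne {a b i : ι} (h : a ≠ b) (ha : i ≠ a) (hb : i ≠ b) (t : ℝ) :
    givens a b t *ᵥ Pi.single i 1 = Pi.single i 1 := by
  ext j
  rw [givens_mulVec_apply h]
  split_ifs with hj hj' <;> simp [*, ha.symm, hb.symm]

theorem givens_mul_givens {a b : ι} (h : a ≠ b) (t u : ℝ) :
    givens a b t * givens a b u = givens a b (t + u) := by
  refine ext_of_mulVec_single fun k => ?_
  rw [← mulVec_mulVec]
  ext i
  simp only [givens_mulVec_apply h, if_neg h.symm, if_true, Real.cos_add, Real.sin_add]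
  split_ifs <;> ring

theorem givens_mem_specialOrthogonalGroup {a b : ι} (h : a ≠ b) (t : ℝ) :
    givens a b t ∈ specialOrthogonalGroup ι ℝ := by
  have orthogonal : givens a b t * (givens a b t)ᵀ = 1 := by
    rw [transpose_givens, givens_mul_givens h, add_neg_cancel]
    simp [givens]
  have det_sq : (givens a b t).det * (givens a b t).det = 1 := by
    simpa using congrArg det orthogonal
  have det_nonneg : 0 ≤ (givens a b t).det := by
    rw [← add_halves t, ← givens_mul_givens h, det_mul]
    exact mul_self_nonneg _
  exact mem_specialOrthogonalGroup_iff.mpr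
    ⟨(mem_orthogonalGroup_iff _ _).mpr orthogonal, by nlinarith⟩

theorem exists_eq_cos_mul_and_eq_sin_mul (x y : ℝ) :
    ∃ r t : ℝ, 0 ≤ r ∧ x = Real.cos t * r ∧ y = Real.sin t * r := by
  refine ⟨‖(⟨x, y⟩ : ℂ)‖, Complex.arg ⟨x, y⟩, norm_nonneg _, ?_, ?_⟩
  · rw [mul_comm, Complex.norm_mul_cos_arg]
  · rw [mul_comm, Complex.norm_mul_sin_arg]

theorem exists_givens_mulVec_eq {a b : ι} (h : a ≠ b) (v : ι → ℝ) :
    ∃ (t : ℝ) (u : ι → ℝ), 0 ≤ u a ∧ u b = 0 ∧ (∀ i, i ≠ a → i ≠ b → u i = v i) ∧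
      v = givens a b t *ᵥ u := by
  obtain ⟨r, t, hr, ha, hb⟩ := exists_eq_cos_mul_and_eq_sin_mul (v a) (v b)
  refine ⟨t, Function.update (Function.update v b 0) a r, ?_, ?_, ?_, ?_⟩
  · simpa using hr
  · simp [h.symm]
  · intro i hia hib
    simp [hia, hib]
  · ext i
    rw [givens_mulVec_apply h]
    split_ifs with hia hib <;> simp [*, h.symm]

theorem exists_prod_givens_mulVec_single (m : ι) (l : List ι) (hm : m ∉ l) (hl : l.Nodup)
    (v : ι → ℝ) (hv : ∀ i, i ≠ m → i ∉ l → v i = 0) :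
    ∃ (t : ι → ℝ) (c : ℝ), (0 ≤ v m ∨ l ≠ [] → 0 ≤ c) ∧
      v = (l.map fun b => givens m b (t b)).prod *ᵥ Pi.single m c := by
  induction l generalizing v with
  | nil =>
    refine ⟨0, v m, by simp, ?_⟩
    ext i
    rcases eq_or_ne i m with rfl | hi
    · simp
    · simp [hi, hv i hi]
  | cons b l ih =>
    obtain ⟨hmb, hml⟩ := List.ne_and_not_mem_of_not_mem_cons hm
    obtain ⟨hbl, hl⟩ := List.nodup_cons.mp hl
    obtain ⟨s, u, hum, hub, hu, rfl⟩ := exists_givens_mulVec_eq hmb v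
    obtain ⟨t, c, hc, rfl⟩ := ih hml hl u fun i him hil => by
      rcases eq_or_ne i b with rfl | hib
      · exact hub
      · rw [hu i him hib, hv i him (List.not_mem_cons_of_ne_of_not_mem hib hil)]
    refine ⟨Function.update t b s, c, fun _ => hc (.inl hum), ?_⟩
    have tail : (l.map fun x => givens m x (Function.update t b s x)) =
        l.map fun x => givens m x (t x) :=
      List.map_congr_left fun x hx => by
        rw [Function.update_of_ne (ne_of_mem_of_not_mem hx hbl)]
    rw [List.map_cons, List.prod_cons, tail, Function.update_self, mulVec_mulVec]

theorem prod_givens_mulVec_single_of_notMem {a i : ι} {l : List ι} (hal : a ∉ l) (hia : i ≠ a)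
    (hil : i ∉ l) (t : ι → ℝ) :
    (l.map fun b => givens a b (t b)).prod *ᵥ Pi.single i 1 = Pi.single i 1 := by
  induction l with
  | nil => exact one_mulVec _
  | cons b l ih =>
    obtain ⟨hab, hal⟩ := List.ne_and_not_mem_of_not_mem_cons hal
    obtain ⟨hib, hil⟩ := List.ne_and_not_mem_of_not_mem_cons hil
    rw [List.map_cons, List.prod_cons, ← mulVec_mulVec, ih hal hil,
      givens_mulVec_single_of_ne hab hia hib]

theorem transpose_mulVec_eq_self {R : Matrix ι ι ℝ} (hR : R ∈ orthogonalGroup ι ℝ) {v : ι → ℝ}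
    (h : R *ᵥ v = v) : Rᵀ *ᵥ v = v := by
  conv_lhs => rw [← h, mulVec_mulVec, (mem_orthogonalGroup_iff' _ _).mp hR, one_mulVec]

theorem apply_eq_zero_of_mulVec_single_eq {R : Matrix ι ι ℝ} (hR : R ∈ orthogonalGroup ι ℝ)
    {i j : ι} (h : R *ᵥ Pi.single i 1 = Pi.single i 1) (hij : j ≠ i) : R i j = 0 := by
  simpa [hij] using congrFun (transpose_mulVec_eq_self hR h) j

theorem dotProduct_mulVec_self {R : Matrix ι ι ℝ} (hR : R ∈ orthogonalGroup ι ℝ) (v : ι → ℝ) :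
    (R *ᵥ v) ⬝ᵥ (R *ᵥ v) = v ⬝ᵥ v := by
  rw [dotProduct_mulVec, vecMul_mulVec, (mem_orthogonalGroup_iff' _ _).mp hR, vecMul_one]

theorem eq_one_of_forall_ne_mulVec_single_eq {R : Matrix ι ι ℝ}
    (hR : R ∈ specialOrthogonalGroup ι ℝ) (a : ι)
    (h : ∀ i, i ≠ a → R *ᵥ Pi.single i 1 = Pi.single i 1) : R = 1 := by
  obtain ⟨hO, hdet⟩ := mem_specialOrthogonalGroup_iff.mp hR
  have apply_of_ne : ∀ i j, j ≠ a → R i j = (1 : Matrix ι ι ℝ) i j := fun i j hj => by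
    simpa [one_apply, Pi.single_apply] using congrFun (h j hj) i
  have eq_diagonal : R = diagonal fun i => R i i := by
    ext i j
    rcases eq_or_ne i j with rfl | hij
    · simp
    rw [diagonal_apply_ne _ hij]
    rcases eq_or_ne j a with rfl | hj
    · exact apply_eq_zero_of_mulVec_single_eq hO (h i hij) hij.symm
    · rw [apply_of_ne i j hj, one_apply_ne hij]
  have diag_a : R a a = 1 := by
    rw [eq_diagonal, det_diagonal] at hdet
    rwa [Fintype.prod_eq_single a fun i hi => by rw [apply_of_ne i i hi, one_apply_eq]] at hdet
  rw [eq_diagonal, diagonal_eq_one]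
  ext i
  rcases eq_or_ne i a with rfl | hi
  · exact diag_a
  · rw [apply_of_ne i i hi, one_apply_eq, Pi.one_apply]

theorem exists_prod_givens_mulVec_single_eq {R : Matrix ι ι ℝ} (hR : R ∈ orthogonalGroup ι ℝ)
    {a : ι} {l : List ι} (hne : l ≠ []) (hal : a ∉ l) (hl : l.Nodup)
    (h : ∀ i, i ≠ a → i ∉ l → R *ᵥ Pi.single i 1 = Pi.single i 1) :
    ∃ t : ι → ℝ, R *ᵥ Pi.single a 1 = (l.map fun b => givens a b (t b)).prod *ᵥ Pi.single a 1 := by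
  obtain ⟨t, c, hc, hv⟩ := exists_prod_givens_mulVec_single a l hal hl (R *ᵥ Pi.single a 1)
    fun i hia hil => by
      simpa using apply_eq_zero_of_mulVec_single_eq hR (h i hia hil) hia.symm
  have prod_mem : (l.map fun b => givens a b (t b)).prod ∈ orthogonalGroup ι ℝ :=
    list_prod_mem <| List.forall_mem_map.mpr fun b hb =>
      (mem_specialOrthogonalGroup_iff.mp
        (givens_mem_specialOrthogonalGroup (ne_of_mem_of_not_mem hb hal).symm (t b))).1
  have c_sq : 1 = c * c := by
    have := dotProduct_mulVec_self hR (Pi.single a 1)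
    rw [hv, dotProduct_mulVec_self prod_mem] at this
    simpa using this.symm
  have c_eq : c = 1 := by nlinarith [hc (.inr hne)]
  exact ⟨t, by rw [hv, c_eq]⟩

end PlaneRotations

section OrderedPairProd

variable {ι M : Type*} [Monoid M]

/-- The product of `f a b` over the pairs of entries of a list with `a` before `b`, taken in
lexicographic order of the positions. -/
def orderedPairProd (f : ι → ι → M) : List ι → M
  | [] => 1
  | a :: l => (l.map (f a)).prod * orderedPairProd f l

theorem orderedPairProd_congr {f g : ι → ι → M} {l : List ι}
    (h : ∀ a ∈ l, ∀ b ∈ l, f a b = g a b) : orderedPairProd f l = orderedPairProd g l := by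
  induction l with
  | nil => rfl
  | cons a l ih =>
    rw [orderedPairProd, orderedPairProd,
      ih fun b hb c hc => h b (List.mem_cons_of_mem a hb) c (List.mem_cons_of_mem a hc),
      List.map_congr_left fun b hb => h a List.mem_cons_self b (List.mem_cons_of_mem a hb)]

theorem orderedPairProd_rel {N : Type*} [Monoid N] {r : M → N → Prop} (one : r 1 1)
    (mul : ∀ {x y x' y'}, r x y → r x' y' → r (x * x') (y * y')) {f : ι → ι → M} {g : ι → ι → N}
    {l : List ι} (hl : l.Nodup) (h : ∀ a b, a ≠ b → r (f a b) (g a b)) :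
    r (orderedPairProd f l) (orderedPairProd g l) := by
  induction l with
  | nil => exact one
  | cons a l ih =>
    obtain ⟨hal, hl⟩ := List.nodup_cons.mp hl
    refine mul (List.rel_prod one (fun _ _ hxy _ _ hxy' => mul hxy hxy') ?_) (ih hl)
    rw [List.forall₂_map_left_iff, List.forall₂_map_right_iff, List.forall₂_same]
    exact fun b hb => h a b (ne_of_mem_of_not_mem hb hal).symm

theorem prod_map_prod_filter_lt_eq_orderedPairProd [LinearOrder ι] (f : ι → ι → M) {l : List ι}
    (hl : l.Pairwise (· < ·)) :
    (l.map fun a => ((l.filter (a < ·)).map (f a)).prod).prod = orderedPairProd f l := by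
  induction l with
  | nil => rfl
  | cons a l ih =>
    obtain ⟨ha, hl⟩ := List.pairwise_cons.mp hl
    have head : (a :: l).filter (a < ·) = l := by
      simpa using ha
    have tail : ∀ b ∈ l, (a :: l).filter (b < ·) = l.filter (b < ·) := fun b hb => by
      simp [(ha b hb).le]
    rw [List.map_cons, List.prod_cons, head, orderedPairProd, ← ih hl]
    congr 2
    exact List.map_congr_left fun b hb => by rw [tail b hb]

end OrderedPairProd

theorem exists_eq_orderedPairProd_givens {ι : Type*} [Fintype ι] [DecidableEq ι] {l : List ι}
    (hl : l.Nodup) {R : Matrix ι ι ℝ} (hR : R ∈ specialOrthogonalGroup ι ℝ)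
    (h : ∀ i ∉ l, R *ᵥ Pi.single i 1 = Pi.single i 1) :
    ∃ θ : ι → ι → ℝ, R = orderedPairProd (fun a b => givens a b (θ a b)) l := by
  induction l generalizing R with
  | nil => exact ⟨0, ext_of_mulVec_single fun i => (h i List.not_mem_nil).trans (one_mulVec _).symm⟩
  | cons a l ih =>
    obtain ⟨hal, hl⟩ := List.nodup_cons.mp hl
    rcases eq_or_ne l [] with rfl | hne
    · exact ⟨0, by
        simpa [orderedPairProd] using eq_one_of_forall_ne_mulVec_single_eq hR a (by simpa using h)⟩
    replace h : ∀ i, i ≠ a → i ∉ l → R *ᵥ Pi.single i 1 = Pi.single i 1 := fun i hia hil =>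
      h i (List.not_mem_cons_of_ne_of_not_mem hia hil)
    obtain ⟨t, ht⟩ := exists_prod_givens_mulVec_single_eq
      (mem_specialOrthogonalGroup_iff.mp hR).1 hne hal hl h
    set Q := (l.map fun b => givens a b (t b)).prod with hQ
    have Q_mem : Q ∈ specialOrthogonalGroup ι ℝ := list_prod_mem <| List.forall_mem_map.mpr
      fun b hb => givens_mem_specialOrthogonalGroup (ne_of_mem_of_not_mem hb hal).symm (t b)
    obtain ⟨star_mul_Q, Q_mul_star⟩ :=
      Unitary.mem_iff.mp (mem_specialOrthogonalGroup_iff.mp Q_mem).1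
    have star_Q_mem : star Q ∈ specialOrthogonalGroup ι ℝ :=
      (star (⟨Q, Q_mem⟩ : specialOrthogonalGroup ι ℝ)).2
    obtain ⟨θ, hθ⟩ := ih hl (mul_mem star_Q_mem hR) fun i hil => by
      have : R *ᵥ Pi.single i 1 = Q *ᵥ Pi.single i 1 := by
        rcases eq_or_ne i a with rfl | hia
        · exact ht
        · rw [h i hia hil, prod_givens_mulVec_single_of_notMem hal hia hil]
      rw [← mulVec_mulVec, this, mulVec_mulVec, star_mul_Q, one_mulVec]
    refine ⟨Function.update θ a t, ?_⟩
    rw [orderedPairProd, Function.update_self, ← hQ, orderedPairProd_congr, ← hθ, ← mul_assoc,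
      Q_mul_star, one_mul]
    intro x hx y _
    rw [Function.update_of_ne (ne_of_mem_of_not_mem hx hal)]

theorem exp_smul_of_mul_self_eq_neg_one {A : Type*} [NormedRing A] [NormedAlgebra ℝ A] {J : A}
    (hJ : J * J = -1) (t : ℝ) :
    NormedSpace.exp (t • J) = Real.cos t • 1 + Real.sin t • J := by
  let : Algebra ℚ A := Algebra.compHom A (algebraMap ℚ ℝ)
  let f : ℂ →ₐ[ℝ] A := Complex.lift ⟨J, hJ⟩
  have f_apply (z : ℂ) : f z = z.re • 1 + z.im • J := by
    rw [← Algebra.algebraMap_eq_smul_one]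
    rfl
  have exp_f := NormedSpace.map_exp f (LinearMap.continuous_of_finiteDimensional f.toLinearMap)
    (t * Complex.I)
  rw [f_apply, f_apply, ← Complex.exp_eq_exp_ℂ, Complex.exp_ofReal_mul_I_re,
    Complex.exp_ofReal_mul_I_im] at exp_f
  simpa using exp_f.symm

theorem commute_list_prod_map_of_even {ι M : Type*} [Monoid M] {x : M} {f : ι → M}
    (h : ∀ a b, Commute x (f a * f b)) : ∀ {l : List ι}, Even l.length → Commute x (l.map f).prod
  | [], _ => Commute.one_right x
  | [_], hl => by simp at hl
  | a :: b :: l, hl => by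
    simp only [List.map_cons, List.prod_cons, ← mul_assoc]
    exact (h a b).mul_right (commute_list_prod_map_of_even h (by simpa [parity_simps] using hl))

/-- A family of Clifford generators: pairwise anticommuting elements of square one. -/
structure IsCliffordFamily {ι A : Type*} [Ring A] (γ : ι → A) : Prop where
  mul_self : ∀ a, γ a * γ a = 1
  anticomm : ∀ {a b}, a ≠ b → γ a * γ b = -(γ b * γ a)

namespace IsCliffordFamily

section Ring

variable {ι A : Type*} [Ring A] {γ : ι → A}

theorem snoc {n : ℕ} {γ : Fin n → A} (hγ : IsCliffordFamily γ) {δ : A} (hδ : δ * δ = 1)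
    (hγδ : ∀ a, γ a * δ = -(δ * γ a)) :
    IsCliffordFamily (Fin.snoc (n := n) (α := fun _ => A) γ δ) where
  mul_self := by
    refine Fin.lastCases ?_ fun a => ?_
    · simpa only [Fin.snoc_last] using hδ
    · simpa only [Fin.snoc_castSucc] using hγ.mul_self a
  anticomm := by
    refine @(Fin.lastCases ?_ fun a => ?_) <;> refine @(Fin.lastCases ?_ fun b => ?_) <;> intro hab
    · exact (hab rfl).elim
    · simp only [Fin.snoc_last, Fin.snoc_castSucc, hγδ, neg_neg]
    · simp only [Fin.snoc_last, Fin.snoc_castSucc, hγδ]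
    · simpa only [Fin.snoc_castSucc] using hγ.anticomm fun h => hab (congrArg Fin.castSucc h)

theorem conj (hγ : IsCliffordFamily γ) {u v : A} (huv : u * v = 1) (hvu : v * u = 1) :
    IsCliffordFamily fun a => v * γ a * u := by
  have mul (a b : ι) : v * γ a * u * (v * γ b * u) = v * (γ a * γ b) * u := by
    calc v * γ a * u * (v * γ b * u) = v * γ a * (u * v) * γ b * u := by noncomm_ring
      _ = v * (γ a * γ b) * u := by rw [huv, mul_one, mul_assoc v]
  exact ⟨fun a => by rw [mul, hγ.mul_self, mul_one, hvu],
    fun h => by rw [mul, mul, hγ.anticomm h, mul_neg, neg_mul]⟩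

theorem pair_mul_self (hγ : IsCliffordFamily γ) {a b : ι} (h : a ≠ b) :
    γ a * γ b * (γ a * γ b) = -1 := by
  calc γ a * γ b * (γ a * γ b) = -(γ b * (γ a * γ a) * γ b) := by
        nth_rw 1 [hγ.anticomm h]
        noncomm_ring
    _ = -1 := by rw [hγ.mul_self, mul_one, hγ.mul_self]

theorem mul_pair_of_mem (hγ : IsCliffordFamily γ) {a b j : ι} (h : a ≠ b) (hj : j = a ∨ j = b) :
    γ j * (γ a * γ b) = -(γ a * γ b * γ j) := by
  rcases hj with rfl | rfl
  · rw [mul_assoc, hγ.anticomm h.symm, mul_neg, neg_neg]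
  · rw [← mul_assoc, hγ.anticomm h.symm, neg_mul]

theorem commute_pair_of_notMem (hγ : IsCliffordFamily γ) {a b j : ι} (ha : j ≠ a) (hb : j ≠ b) :
    Commute (γ j) (γ a * γ b) := by
  rw [Commute, SemiconjBy, ← mul_assoc, hγ.anticomm ha, neg_mul, mul_assoc, hγ.anticomm hb,
    mul_neg, neg_neg, mul_assoc]

end Ring

section Algebra

variable {ι K A : Type*} [Fintype ι] [Field K] [Ring A] [Algebra K A] {γ : ι → A}

theorem anticommutator (hγ : IsCliffordFamily γ) (v w : ι → K) :
    (∑ i, v i • γ i) * (∑ i, w i • γ i) + (∑ i, w i • γ i) * (∑ i, v i • γ i) =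
      (2 * (v ⬝ᵥ w)) • (1 : A) := by
  classical
  have pair (i j : ι) :
      γ i * γ j + γ j * γ i = (if i = j then 2 else 0 : K) • (1 : A) := by
    split_ifs with h
    · rw [h, hγ.mul_self, two_smul]
    · rw [hγ.anticomm h, neg_add_cancel, zero_smul]
  simp only [Finset.sum_mul_sum, smul_mul_smul_comm]
  rw [Finset.sum_comm (f := fun i j => (w i * v j) • (γ i * γ j)), ← Finset.sum_add_distrib]
  simp only [← Finset.sum_add_distrib, mul_comm (w _) (v _), ← smul_add, pair, smul_smul,
    ← Finset.sum_smul, mul_ite, mul_zero, Finset.sum_ite_eq, Finset.mem_univ, if_true, dotProduct]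
  rw [← Finset.sum_mul, mul_comm]

theorem anticommutator_single (hγ : IsCliffordFamily γ) (v : ι → K) (i : ι) :
    γ i * (∑ j, v j • γ j) + (∑ j, v j • γ j) * γ i = (2 * v i) • (1 : A) := by
  classical
  simpa [Pi.single_apply, ite_smul] using hγ.anticommutator (Pi.single i 1) v

theorem sum_smul_mul_self [NeZero (2 : K)] (hγ : IsCliffordFamily γ) (v : ι → K) :
    (∑ i, v i • γ i) * (∑ i, v i • γ i) = (v ⬝ᵥ v) • (1 : A) := by
  have := hγ.anticommutator v v
  rw [← two_smul K, mul_smul] at this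
  exact smul_right_injective _ (NeZero.ne (2 : K)) this

omit [Fintype ι] in
theorem linearIndependent [NeZero (2 : K)] [Nontrivial A] (hγ : IsCliffordFamily γ) :
    LinearIndependent K γ := by
  refine linearIndependent_iff_finset_linearIndependent.mpr fun s =>
    Fintype.linearIndependent_iff.mpr fun v hv i => ?_
  have hs : IsCliffordFamily (γ ∘ ((↑) : s → ι)) :=
    ⟨fun a => hγ.mul_self a, fun h => hγ.anticomm (Subtype.coe_injective.ne h)⟩
  have := hs.anticommutator_single v i
  rw [hv, mul_zero, zero_mul, add_zero, eq_comm, smul_eq_zero_iff_left one_ne_zero] at this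
  exact (mul_eq_zero.mp this).resolve_left (NeZero.ne 2)

variable [DecidableEq ι]

theorem smul_injective [NeZero (2 : K)] [Nontrivial A] (hγ : IsCliffordFamily γ) :
    Function.Injective fun R : Matrix ι ι K => R • γ := fun R S h => by
  refine funext fun i => (hγ.linearIndependent (K := K)).fintypeLinearCombination_injective ?_
  exact congrFun h i

theorem mul_transpose_eq_one [NeZero (2 : K)] [Nontrivial A] (hγ : IsCliffordFamily γ)
    {R : Matrix ι ι K} (hR : IsCliffordFamily (R • γ)) : R * Rᵀ = 1 := by
  ext i j
  have h := hR.anticommutator_single (Pi.single j (1 : K)) i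
  simp only [Pi.single_apply, ite_smul, one_smul, zero_smul, Finset.sum_ite_eq', Finset.mem_univ,
    if_true, Module.smul_apply] at h
  rw [hγ.anticommutator] at h
  have h := mul_left_cancel₀ (NeZero.ne (2 : K)) (smul_left_injective K (one_ne_zero (α := A)) h)
  exact h.trans (one_apply ..).symm

theorem exists_reflection [NeZero (2 : K)] [Nontrivial A] (hγ : IsCliffordFamily γ) {w : ι → K}
    (hw : IsUnit (∑ j, w j • γ j)) :
    ∃ R : Matrix ι ι K, R.det = (-1) ^ (Fintype.card ι + 1) ∧
      ∀ i, γ i * ∑ j, w j • γ j = (∑ j, w j • γ j) * (R • γ) i := by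
  have w_ne : w ⬝ᵥ w ≠ 0 := fun h => by
    have := hw.mul hw
    rw [hγ.sum_smul_mul_self, h, zero_smul] at this
    exact not_isUnit_zero this
  set R : Matrix ι ι K := -(1 + vecMulVec (-(2 / (w ⬝ᵥ w)) • w) w) with hR
  have R_smul (i : ι) : (R • γ) i = (2 / (w ⬝ᵥ w) * w i) • (∑ j, w j • γ j) - γ i := by
    have : (vecMulVec (-(2 / (w ⬝ᵥ w)) • w) w • γ) i =
        (-(2 / (w ⬝ᵥ w)) * w i) • ∑ j, w j • γ j := by
      simp only [Module.smul_apply, vecMulVec_apply, Pi.smul_apply, smul_eq_mul, Finset.smul_sum,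
        smul_smul]
    rw [hR, neg_smul, add_smul, one_smul, Pi.neg_apply, Pi.add_apply, this]
    module
  refine ⟨R, ?_, fun i => ?_⟩
  · rw [hR, det_neg, vecMulVec_eq Unit, det_one_add_replicateCol_mul_replicateRow, dotProduct_smul,
      smul_eq_mul, neg_mul, div_mul_cancel₀ _ w_ne]
    ring
  · rw [R_smul, mul_sub, mul_smul_comm, hγ.sum_smul_mul_self, smul_smul, eq_sub_iff_add_eq,
      hγ.anticommutator_single]
    field_simp

theorem exists_intertwines_list_prod [NeZero (2 : K)] [Nontrivial A] (hγ : IsCliffordFamily γ) :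
    ∀ {l : List (ι → K)}, (∀ w ∈ l, IsUnit (∑ j, w j • γ j)) →
    ∃ R : Matrix ι ι K, R.det = ((-1) ^ (Fintype.card ι + 1)) ^ l.length ∧
      ∀ i, γ i * (l.map fun w => ∑ j, w j • γ j).prod =
        (l.map fun w => ∑ j, w j • γ j).prod * (R • γ) i
  | [], _ => ⟨1, by simp, fun i => by rw [one_smul]; simp⟩
  | w :: l, hl => by
    obtain ⟨hw, hl⟩ := List.forall_mem_cons.mp hl
    obtain ⟨R, det_R, hR⟩ := hγ.exists_reflection hw
    obtain ⟨S, det_S, hS⟩ := hγ.exists_intertwines_list_prod hl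
    refine ⟨R * S, by rw [det_mul, det_R, det_S, List.length_cons, pow_succ' _ l.length],
      fun i => ?_⟩
    rw [List.map_cons, List.prod_cons]
    set Q := (l.map fun w => ∑ j, w j • γ j).prod
    calc γ i * ((∑ j, w j • γ j) * Q) = (∑ j, w j • γ j) * ((R • γ) i * Q) := by
          rw [← mul_assoc, hR, mul_assoc]
      _ = (∑ j, w j • γ j) * (Q * (R • S • γ) i) := by
          simp only [Module.smul_apply R, Finset.sum_mul, Finset.mul_sum, smul_mul_assoc,
            mul_smul_comm, hS]
      _ = (∑ j, w j • γ j) * Q * ((R * S) • γ) i := by rw [mul_smul, mul_assoc]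

end Algebra

theorem trace_mul {ι m K : Type*} [DecidableEq ι] [Fintype m] [DecidableEq m] [Field K]
    [NeZero (2 : K)] {γ : ι → Matrix m m K} (hγ : IsCliffordFamily γ) (a b : ι) :
    trace (γ a * γ b) = if a = b then (Fintype.card m : K) else 0 := by
  split_ifs with h
  · rw [h, hγ.mul_self, trace_one]
  · have := congrArg trace (hγ.anticomm h)
    rw [trace_neg, trace_mul_comm (γ b), eq_neg_iff_add_eq_zero, ← two_mul] at this
    exact (mul_eq_zero.mp this).resolve_left (NeZero.ne 2)

end IsCliffordFamily

theorem conjTranspose_pauli (i : Fin 4) : (pauli i)ᴴ = pauli i := by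
  fin_cases i <;> ext a b <;> fin_cases a <;> fin_cases b <;> simp [pauli]

theorem pauli_mul_self (i : Fin 4) : pauli i * pauli i = 1 := by
  fin_cases i <;> ext a b <;> fin_cases a <;> fin_cases b <;> simp [pauli]

theorem pauli_one_mul_pauli_two : pauli 1 * pauli 2 = Complex.I • pauli 3 := by
  ext a b; fin_cases a <;> fin_cases b <;> simp [pauli]

theorem pauli_two_mul_pauli_three : pauli 2 * pauli 3 = Complex.I • pauli 1 := by
  ext a b; fin_cases a <;> fin_cases b <;> simp [pauli]

theorem pauli_three_mul_pauli_one : pauli 3 * pauli 1 = Complex.I • pauli 2 := by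
  ext a b; fin_cases a <;> fin_cases b <;> simp [pauli]

theorem pauli_mul_eq_of_pauli_mul_eq {i j k : Fin 4} {z : ℂ} (h : pauli i * pauli j = z • pauli k) :
    pauli j * pauli i = star z • pauli k := by
  rw [← conjTranspose_pauli i, ← conjTranspose_pauli j, ← conjTranspose_mul, h,
    conjTranspose_smul, conjTranspose_pauli]

theorem pauli_anticomm {i j : Fin 4} (hi : i ≠ 0) (hj : j ≠ 0) (hij : i ≠ j) :
    pauli i * pauli j = -(pauli j * pauli i) := by
  fin_cases i <;> fin_cases j <;> simp at hi hj hij <;> ext a b <;> fin_cases a <;> fin_cases b <;>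
    simp [pauli]

theorem exists_pauli_mul (i j : Fin 4) :
    ∃ (z : ℂ) (k : Fin 4), z ^ 4 = 1 ∧ pauli i * pauli j = z • pauli k := by
  wlog hij : i ≤ j generalizing i j
  · obtain ⟨z, k, hz, h⟩ := this j i (le_of_not_ge hij)
    exact ⟨star z, k, by rw [← star_pow, hz, star_one], pauli_mul_eq_of_pauli_mul_eq h⟩
  have cases : i = 0 ∨ i = j ∨ (i = 1 ∧ j = 2) ∨ (i = 2 ∧ j = 3) ∨ (i = 1 ∧ j = 3) := by
    revert i j; decide
  rcases cases with rfl | rfl | ⟨rfl, rfl⟩ | ⟨rfl, rfl⟩ | ⟨rfl, rfl⟩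
  · exact ⟨1, j, one_pow 4, by rw [one_smul]; exact Matrix.one_mul _⟩
  · exact ⟨1, 0, one_pow 4, by rw [one_smul, pauli_mul_self]; rfl⟩
  · exact ⟨_, _, Complex.I_pow_four, pauli_one_mul_pauli_two⟩
  · exact ⟨_, _, Complex.I_pow_four, pauli_two_mul_pauli_three⟩
  · exact ⟨_, _, by rw [← star_pow, Complex.I_pow_four, star_one],
      pauli_mul_eq_of_pauli_mul_eq pauli_three_mul_pauli_one⟩

/-- The operator `P ⊗ M` on `ℓ + 1` qubits, bilinear in `P` and `M`. This is `P ⊗ₖ M` with its type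
folded back to `VOp (ℓ + 1)`, since `QIdx (ℓ + 1)` is a product only after unfolding. -/
noncomputable def tensorLeft {ℓ : ℕ} :
    Matrix (Fin 2) (Fin 2) ℂ →ₗ[ℂ] VOp ℓ →ₗ[ℂ] VOp (ℓ + 1) :=
  kroneckerMapBilinear (LinearMap.mul ℂ ℂ)

section Recursion

variable {ℓ : ℕ}

theorem tensorLeft_mul (P Q : Matrix (Fin 2) (Fin 2) ℂ) (M N : VOp ℓ) :
    tensorLeft P M * tensorLeft Q N = tensorLeft (P * Q) (M * N) :=
  (mul_kronecker_mul P Q M N).symm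

theorem tensorLeft_one_one : tensorLeft 1 (1 : VOp ℓ) = 1 :=
  one_kronecker_one

theorem conjTranspose_tensorLeft (P : Matrix (Fin 2) (Fin 2) ℂ) (M : VOp ℓ) :
    (tensorLeft P M)ᴴ = tensorLeft Pᴴ Mᴴ :=
  conjTranspose_kronecker P M

theorem tensorLeft_injective {P : Matrix (Fin 2) (Fin 2) ℂ} (hP : P ≠ 0) :
    Function.Injective (tensorLeft (ℓ := ℓ) P) := fun M N h => by
  obtain ⟨a, b, hab⟩ : ∃ a b, P a b ≠ 0 := by
    by_contra! h
    exact hP (Matrix.ext h)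
  ext x y
  exact mul_left_cancel₀ hab (congrFun₂ h (a, x) (b, y))

theorem list_prod_map_tensorLeft (P : Matrix (Fin 2) (Fin 2) ℂ) (l : List (VOp ℓ)) :
    (l.map (tensorLeft P)).prod = tensorLeft (P ^ l.length) l.prod := by
  induction l with
  | nil => exact tensorLeft_one_one.symm
  | cons M l ih =>
    rw [List.map_cons, List.prod_cons, ih, tensorLeft_mul, List.length_cons, pow_succ',
      List.prod_cons]

theorem Γ_succ : Γ (ℓ + 1) =
    Fin.snoc (n := 2 * ℓ + 2) (α := fun _ => VOp (ℓ + 1))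
      (Fin.snoc (n := 2 * ℓ + 1) (α := fun _ => VOp (ℓ + 1))
        (fun i => tensorLeft (pauli 1) (Γ ℓ i)) (tensorLeft (pauli 2) 1))
      (tensorLeft (pauli 3) 1) := rfl

theorem Γ_castSucc_castSucc (i : Site ℓ) :
    Γ (ℓ + 1) i.castSucc.castSucc = tensorLeft (pauli 1) (Γ ℓ i) := by
  rw [Γ_succ]
  exact (Fin.snoc_castSucc (n := 2 * ℓ + 2) ..).trans (Fin.snoc_castSucc (n := 2 * ℓ + 1) ..)

theorem Γ_castSucc_last :
    Γ (ℓ + 1) (Fin.last (2 * ℓ + 1)).castSucc = tensorLeft (pauli 2) 1 := by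
  rw [Γ_succ]
  exact (Fin.snoc_castSucc (n := 2 * ℓ + 2) ..).trans (Fin.snoc_last (n := 2 * ℓ + 1) ..)

theorem Γ_last : Γ (ℓ + 1) (Fin.last (2 * ℓ + 2)) = tensorLeft (pauli 3) 1 := by
  rw [Γ_succ]
  exact Fin.snoc_last (n := 2 * ℓ + 2) ..

theorem forall_site_succ {P : Site (ℓ + 1) → Prop} (old : ∀ i : Site ℓ, P i.castSucc.castSucc)
    (penultimate : P (Fin.last (2 * ℓ + 1)).castSucc) (last : P (Fin.last (2 * ℓ + 2)))
    (i : Site (ℓ + 1)) : P i :=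
  Fin.lastCases (n := 2 * ℓ + 2) last (fun j =>
    Fin.lastCases (n := 2 * ℓ + 1) (motive := fun j => P j.castSucc) penultimate old j) i

theorem conjTranspose_Γ : ∀ {ℓ : ℕ} (a : Site ℓ), (Γ ℓ a)ᴴ = Γ ℓ a
  | 0 => fun _ => conjTranspose_one
  | ℓ + 1 => forall_site_succ
      (fun i => by
        rw [Γ_castSucc_castSucc, conjTranspose_tensorLeft, conjTranspose_pauli, conjTranspose_Γ])
      (by rw [Γ_castSucc_last, conjTranspose_tensorLeft, conjTranspose_pauli, conjTranspose_one])
      (by rw [Γ_last, conjTranspose_tensorLeft, conjTranspose_pauli, conjTranspose_one])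

theorem tensorLeft_pauli_mul_self {M : VOp ℓ} (hM : M * M = 1) (i : Fin 4) :
    tensorLeft (pauli i) M * tensorLeft (pauli i) M = 1 := by
  rw [tensorLeft_mul, pauli_mul_self, hM, tensorLeft_one_one]

theorem tensorLeft_pauli_anticomm {i j : Fin 4} (hi : i ≠ 0) (hj : j ≠ 0) (hij : i ≠ j)
    {M N : VOp ℓ} (h : Commute M N) :
    tensorLeft (pauli i) M * tensorLeft (pauli j) N =
      -(tensorLeft (pauli j) N * tensorLeft (pauli i) M) := by
  rw [tensorLeft_mul, tensorLeft_mul, pauli_anticomm hi hj hij, h.eq, LinearMap.map_neg₂]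

theorem isCliffordFamily_Γ : ∀ ℓ : ℕ, IsCliffordFamily (Γ ℓ)
  | 0 => ⟨fun _ => Matrix.mul_one _, fun h => (h (Subsingleton.elim (α := Fin 1) _ _)).elim⟩
  | ℓ + 1 => by
    have ih := isCliffordFamily_Γ ℓ
    have old : IsCliffordFamily fun i => tensorLeft (pauli 1) (Γ ℓ i) :=
      ⟨fun i => tensorLeft_pauli_mul_self (ih.mul_self i) 1, fun h => by
        rw [tensorLeft_mul, ih.anticomm h, map_neg, ← tensorLeft_mul]⟩
    rw [Γ_succ]
    refine (old.snoc (tensorLeft_pauli_mul_self (mul_one 1) 2) fun i => ?_).snoc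
      (tensorLeft_pauli_mul_self (mul_one 1) 3) (Fin.lastCases ?_ fun i => ?_)
    · exact tensorLeft_pauli_anticomm (by decide) (by decide) (by decide) (Commute.one_right _)
    · rw [Fin.snoc_last]
      exact tensorLeft_pauli_anticomm (by decide) (by decide) (by decide) (Commute.one_right _)
    · rw [Fin.snoc_castSucc]
      exact tensorLeft_pauli_anticomm (by decide) (by decide) (by decide) (Commute.one_right _)

theorem pauliString_cons (q : Fin 4) (p : Fin ℓ → Fin 4) :
    pauliString (ℓ + 1) (Fin.cons q p) = tensorLeft (pauli q) (pauliString ℓ p) := rfl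

theorem pauliString_zero : ∀ ℓ : ℕ, pauliString ℓ 0 = 1
  | 0 => rfl
  | ℓ + 1 => (congrArg (tensorLeft 1) (pauliString_zero ℓ)).trans tensorLeft_one_one

theorem exists_Γ_eq_pauliString :
    ∀ {ℓ : ℕ} (a : Site ℓ), ∃ p : Fin ℓ → Fin 4, Γ ℓ a = pauliString ℓ p
  | 0 => fun _ => ⟨0, rfl⟩
  | ℓ + 1 => forall_site_succ
      (fun i =>
        have ⟨p, hp⟩ := exists_Γ_eq_pauliString i
        ⟨Fin.cons 1 p, by rw [Γ_castSucc_castSucc, pauliString_cons, hp]⟩)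
      ⟨Fin.cons 2 0, by rw [Γ_castSucc_last, pauliString_cons, pauliString_zero]⟩
      ⟨Fin.cons 3 0, by rw [Γ_last, pauliString_cons, pauliString_zero]⟩

theorem exists_pauliString_mul : ∀ {ℓ : ℕ} (p q : Fin ℓ → Fin 4), ∃ (z : ℂ) (r : Fin ℓ → Fin 4),
    z ^ 4 = 1 ∧ pauliString ℓ p * pauliString ℓ q = z • pauliString ℓ r
  | 0, _, _ => ⟨1, 0, one_pow 4, by rw [one_smul]; exact Matrix.mul_one _⟩
  | ℓ + 1, p, q => by
    obtain ⟨z, r, hz, hr⟩ := exists_pauliString_mul (Fin.tail p) (Fin.tail q)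
    obtain ⟨y, k, hy, hk⟩ := exists_pauli_mul (p 0) (q 0)
    refine ⟨y * z, Fin.cons k r, by rw [mul_pow, hy, hz, mul_one], ?_⟩
    rw [← Fin.cons_self_tail p, ← Fin.cons_self_tail q, pauliString_cons, pauliString_cons,
      pauliString_cons, tensorLeft_mul, hr, hk, LinearMap.map_smul₂, map_smul, smul_smul]

variable (ℓ) in
/-- The Pauli group on `ℓ` qubits: the tensor products of Pauli matrices, up to a fourth root of
unity. -/
def pauliGroup : Submonoid (VOp ℓ) where
  carrier := {B | ∃ (z : ℂ) (p : Fin ℓ → Fin 4), z ^ 4 = 1 ∧ B = z • pauliString ℓ p}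
  one_mem' := ⟨1, 0, one_pow 4, by rw [one_smul, pauliString_zero]⟩
  mul_mem' := by
    rintro _ _ ⟨z, p, hz, rfl⟩ ⟨y, q, hy, rfl⟩
    obtain ⟨x, r, hx, hr⟩ := exists_pauliString_mul p q
    exact ⟨z * y * x, r, by rw [mul_pow, mul_pow, hz, hy, hx, mul_one, mul_one],
      by rw [smul_mul_smul_comm, hr, smul_smul]⟩

theorem byproducts_le_pauliGroup : byproducts ℓ ≤ pauliGroup ℓ :=
  Submonoid.closure_le.mpr <| Set.range_subset_iff.mpr fun a =>
    have ⟨p, hp⟩ := exists_Γ_eq_pauliString a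
    ⟨1, p, one_pow 4, by rw [one_smul, hp]⟩

end Recursion

theorem prod_pauli : pauli 1 * pauli 2 * pauli 3 = Complex.I • 1 := by
  rw [pauli_one_mul_pauli_two, smul_mul_assoc, pauli_mul_self]

theorem eq_smul_one_of_commute_pauli {P : Matrix (Fin 2) (Fin 2) ℂ}
    (hY : pauli 2 * P = P * pauli 2) (hZ : pauli 3 * P = P * pauli 3) : P = P 0 0 • 1 := by
  have h01 := congrFun₂ hZ 0 1
  have h10 := congrFun₂ hZ 1 0
  have h11 := congrFun₂ hY 1 0
  simp only [pauli, cons_val, mul_apply, of_apply, cons_val', cons_val_fin_one, cons_val_zero,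
    cons_val_one, Fin.sum_univ_two, one_mul, zero_mul, add_zero, zero_add, mul_zero, mul_neg,
    mul_one, neg_mul, self_eq_neg, neg_eq_self, mul_comm _ Complex.I, mul_eq_mul_left_iff,
    Complex.I_ne_zero, or_false] at h01 h10 h11
  ext a b
  fin_cases a <;> fin_cases b <;> simp [h01, h10, h11]

theorem exists_eq_one_kronecker_of_commute {m : Type*} [Fintype m] [DecidableEq m]
    {M : Matrix (Fin 2 × m) (Fin 2 × m) ℂ} (hY : (pauli 2 ⊗ₖ 1) * M = M * (pauli 2 ⊗ₖ 1))
    (hZ : (pauli 3 ⊗ₖ 1) * M = M * (pauli 3 ⊗ₖ 1)) :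
    ∃ M' : Matrix m m ℂ, M = 1 ⊗ₖ M' := by
  let block (x y : m) : Matrix (Fin 2) (Fin 2) ℂ := of fun a b => M (a, x) (b, y)
  have commute_block {P : Matrix (Fin 2) (Fin 2) ℂ} (hP : (P ⊗ₖ 1) * M = M * (P ⊗ₖ 1)) (x y : m) :
      P * block x y = block x y * P := by
    ext a b
    simpa [mul_apply, Fintype.sum_prod_type, one_apply, block] using congrFun₂ hP (a, x) (b, y)
  refine ⟨of fun x y => M (0, x) (0, y), ?_⟩
  ext ⟨a, x⟩ ⟨b, y⟩
  have := eq_smul_one_of_commute_pauli (commute_block hY x y) (commute_block hZ x y)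
  exact (congrFun₂ this a b).trans (mul_comm ..)

theorem eq_smul_one_of_commute_Γ :
    ∀ {ℓ : ℕ} {M : VOp ℓ}, (∀ a, Γ ℓ a * M = M * Γ ℓ a) → ∃ z : ℂ, M = z • 1
  | 0, M, _ => ⟨M () (), Matrix.ext fun _ _ => (mul_one (M () ())).symm⟩
  | ℓ + 1, M, h => by
    have hY : tensorLeft (pauli 2) 1 * M = M * tensorLeft (pauli 2) 1 := by
      rw [← Γ_castSucc_last, h]
    have hZ : tensorLeft (pauli 3) 1 * M = M * tensorLeft (pauli 3) 1 := by
      rw [← Γ_last, h]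
    obtain ⟨M', rfl : M = tensorLeft 1 M'⟩ := exists_eq_one_kronecker_of_commute hY hZ
    obtain ⟨z, rfl⟩ := eq_smul_one_of_commute_Γ (M := M') fun a => by
      have := h a.castSucc.castSucc
      rw [Γ_castSucc_castSucc, tensorLeft_mul, tensorLeft_mul, one_mul, mul_one] at this
      exact tensorLeft_injective (fun h => by simpa [pauli] using congrFun₂ h 0 1) this
    exact ⟨z, by rw [map_smul, tensorLeft_one_one]⟩

theorem ofFn_Γ_succ (ℓ : ℕ) : List.ofFn (Γ (ℓ + 1)) =
    (List.ofFn (Γ ℓ)).map (tensorLeft (pauli 1)) ++ [tensorLeft (pauli 2) 1] ++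
      [tensorLeft (pauli 3) 1] := by
  refine List.ofFn_succ_last.trans ?_
  rw [← Γ_last]
  refine congrArg (· ++ _) (List.ofFn_succ_last.trans ?_)
  rw [← Γ_castSucc_last, List.map_ofFn]
  exact congrArg (List.ofFn · ++ _) (funext Γ_castSucc_castSucc)

theorem prod_Γ : ∀ ℓ : ℕ, (List.ofFn (Γ ℓ)).prod = Complex.I ^ ℓ • 1
  | 0 => by
    rw [pow_zero, one_smul]
    exact mul_one 1
  | ℓ + 1 => by
    have pauli_pow : pauli 1 ^ (2 * ℓ + 1) = pauli 1 := by
      rw [pow_succ, pow_mul, pow_two, pauli_mul_self, one_pow, one_mul]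
    rw [ofFn_Γ_succ, List.prod_append, List.prod_append, list_prod_map_tensorLeft,
      List.prod_singleton, List.prod_singleton, List.length_ofFn, pauli_pow, prod_Γ ℓ,
      tensorLeft_mul, tensorLeft_mul, prod_pauli, mul_one, mul_one, LinearMap.map_smul₂, map_smul,
      tensorLeft_one_one, smul_smul, pow_succ']

/- Since the product of all the `Γ a` is a nonzero scalar, each `Γ a` is up to a scalar the product
of the `2ℓ + 2` factors in `a :: List.finRange (2ℓ + 1)`, hence an even element. -/
theorem eq_smul_one_of_commute_Γ_mul_Γ {ℓ : ℕ} {M : VOp ℓ}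
    (h : ∀ a b, a ≠ b → Commute M (Γ ℓ a * Γ ℓ b)) : ∃ z : ℂ, M = z • 1 := by
  refine eq_smul_one_of_commute_Γ fun a => ?_
  have even_commute (a b : Site ℓ) : Commute M (Γ ℓ a * Γ ℓ b) := by
    rcases eq_or_ne a b with rfl | hab
    · rw [(isCliffordFamily_Γ ℓ).mul_self]
      exact Commute.one_right M
    · exact h a b hab
  have := commute_list_prod_map_of_even even_commute (l := a :: List.finRange (2 * ℓ + 1))
    (by simp [parity_simps])
  rw [List.map_cons, List.prod_cons, ← List.ofFn_eq_map, prod_Γ, mul_smul_comm, mul_one,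
    Commute.smul_right_iff₀ (pow_ne_zero ℓ Complex.I_ne_zero)] at this
  exact this.symm.eq

section Rot

variable {ℓ : ℕ} {a b j : Site ℓ}

theorem gen_eq_smul (h : a ≠ b) : gen ℓ a b = -Complex.I • (Γ ℓ a * Γ ℓ b) := by
  rw [gen, (isCliffordFamily_Γ ℓ).anticomm h.symm, sub_neg_eq_add, ← two_smul ℂ, smul_smul,
    one_div_mul_eq_div, div_mul_cancel_left₀ two_ne_zero, Complex.inv_I]

open scoped Matrix.Norms.Operator in
theorem rot_eq (h : a ≠ b) (θ : ℝ) :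
    rot ℓ a b θ = Real.cos θ • 1 - Real.sin θ • (Γ ℓ a * Γ ℓ b) := by
  have exponent : -(Complex.I * (θ : ℂ)) • gen ℓ a b = (-θ) • (Γ ℓ a * Γ ℓ b) := by
    rw [gen_eq_smul h, smul_smul, ← Complex.coe_smul, Complex.ofReal_neg]
    congr 1
    linear_combination (θ : ℂ) * Complex.I_mul_I
  rw [rot, exponent]
  refine (exp_smul_of_mul_self_eq_neg_one ((isCliffordFamily_Γ ℓ).pair_mul_self h) (-θ)).trans ?_
  rw [Real.cos_neg, Real.sin_neg, neg_smul, sub_eq_add_neg]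

theorem rot_zero (h : a ≠ b) : rot ℓ a b 0 = 1 := by
  simp [rot_eq h]

theorem rot_mul_rot (h : a ≠ b) (θ φ : ℝ) : rot ℓ a b θ * rot ℓ a b φ = rot ℓ a b (θ + φ) := by
  simp only [rot_eq h, Real.cos_add, Real.sin_add, sub_mul, mul_sub, smul_mul_smul_comm,
    (isCliffordFamily_Γ ℓ).pair_mul_self h, mul_one, one_mul]
  module

theorem conjTranspose_rot (h : a ≠ b) (θ : ℝ) : (rot ℓ a b θ)ᴴ = rot ℓ a b (-θ) := by
  rw [rot_eq h, rot_eq h, conjTranspose_sub, conjTranspose_smul, conjTranspose_smul,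
    conjTranspose_one, conjTranspose_mul, conjTranspose_Γ, conjTranspose_Γ,
    (isCliffordFamily_Γ ℓ).anticomm h.symm, Real.cos_neg, Real.sin_neg, star_trivial,
    star_trivial, smul_neg, neg_smul]

theorem Γ_mul_rot_of_mem (h : a ≠ b) (hj : j = a ∨ j = b) (θ : ℝ) :
    Γ ℓ j * rot ℓ a b θ = rot ℓ a b (-θ) * Γ ℓ j := by
  rw [rot_eq h, rot_eq h, mul_sub, sub_mul, mul_smul_comm, mul_smul_comm,
    (isCliffordFamily_Γ ℓ).mul_pair_of_mem h hj, Real.cos_neg, Real.sin_neg, smul_mul_assoc,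
    smul_mul_assoc, mul_one, one_mul, smul_neg, neg_smul]

theorem Γ_mul_rot_of_notMem (h : a ≠ b) (ha : j ≠ a) (hb : j ≠ b) (θ : ℝ) :
    Γ ℓ j * rot ℓ a b θ = rot ℓ a b θ * Γ ℓ j := by
  rw [rot_eq h, mul_sub, sub_mul, mul_smul_comm, mul_smul_comm,
    ((isCliffordFamily_Γ ℓ).commute_pair_of_notMem ha hb).eq, smul_mul_assoc, smul_mul_assoc,
    mul_one, one_mul]

theorem conj_rot_Γ_of_mem (h : a ≠ b) (hj : j = a ∨ j = b) (θ : ℝ) :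
    (rot ℓ a b θ)ᴴ * Γ ℓ j * rot ℓ a b θ = Γ ℓ j * rot ℓ a b (2 * θ) := by
  rw [conjTranspose_rot h, ← Γ_mul_rot_of_mem h hj, mul_assoc, rot_mul_rot h, two_mul]

theorem conj_rot_Γ_of_notMem (h : a ≠ b) (ha : j ≠ a) (hb : j ≠ b) (θ : ℝ) :
    (rot ℓ a b θ)ᴴ * Γ ℓ j * rot ℓ a b θ = Γ ℓ j := by
  rw [conjTranspose_rot h, ← Γ_mul_rot_of_notMem h ha hb, mul_assoc, rot_mul_rot h,
    neg_add_cancel, rot_zero h, mul_one]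

theorem rot_mem_spinGates (h : a ≠ b) (θ : ℝ) : rot ℓ a b θ ∈ spinGates ℓ :=
  Submonoid.subset_closure ⟨a, b, h, θ, rfl⟩

end Rot

theorem spinGates_le_unitaryGroup (ℓ : ℕ) : spinGates ℓ ≤ unitaryGroup (QIdx ℓ) ℂ := by
  refine Submonoid.closure_le.mpr ?_
  rintro _ ⟨a, b, h, θ, rfl⟩
  exact mem_unitaryGroup_iff'.mpr <| by
    rw [star_eq_conjTranspose, conjTranspose_rot h, rot_mul_rot h, neg_add_cancel, rot_zero h]

theorem byproducts_le_unitaryGroup (ℓ : ℕ) : byproducts ℓ ≤ unitaryGroup (QIdx ℓ) ℂ := by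
  refine Submonoid.closure_le.mpr <| Set.range_subset_iff.mpr fun a => ?_
  exact mem_unitaryGroup_iff'.mpr <| by
    rw [star_eq_conjTranspose, conjTranspose_Γ, (isCliffordFamily_Γ ℓ).mul_self]

theorem Γ_mem_unitaryGroup {ℓ : ℕ} (a : Site ℓ) : Γ ℓ a ∈ unitaryGroup (QIdx ℓ) ℂ :=
  byproducts_le_unitaryGroup ℓ (Submonoid.subset_closure ⟨a, rfl⟩)

instance instNonemptyQIdx (ℓ : ℕ) : Nonempty (QIdx ℓ) :=
  Fintype.card_pos_iff.mp (card_qIdx ℓ ▸ pow_pos two_pos ℓ)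

section Covers

variable {ℓ : ℕ} {V V' : VOp ℓ} {R R' : Matrix (Site ℓ) (Site ℓ) ℝ}

theorem covers_iff : Covers ℓ V R ↔ (fun i => Vᴴ * Γ ℓ i * V) = R • Γ ℓ :=
  funext_iff.symm

theorem conj_smul_Γ (S : Matrix (Site ℓ) (Site ℓ) ℝ) (U : VOp ℓ) :
    (fun i => U * (S • Γ ℓ) i * V) = S • fun i => U * Γ ℓ i * V := by
  funext i
  simp only [Module.smul_apply, Finset.mul_sum, Finset.sum_mul, mul_smul_comm, smul_mul_assoc]

theorem covers_one (ℓ : ℕ) : Covers ℓ 1 1 :=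
  covers_iff.mpr <| by simp

namespace Covers

theorem mul (h : Covers ℓ V R) (h' : Covers ℓ V' R') : Covers ℓ (V * V') (R * R') := by
  rw [covers_iff] at h h' ⊢
  calc (fun i => (V * V')ᴴ * Γ ℓ i * (V * V'))
    _ = fun i => V'ᴴ * (Vᴴ * Γ ℓ i * V) * V' := by simp only [conjTranspose_mul, mul_assoc]
    _ = fun i => V'ᴴ * (R • Γ ℓ) i * V' := by rw [← h]
    _ = (R * R') • Γ ℓ := by rw [conj_smul_Γ, h', mul_smul]

theorem smul (h : Covers ℓ V R) {z : ℂ} (hz : ‖z‖ = 1) : Covers ℓ (z • V) R := fun i => by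
  have star_mul_self : star z * z = 1 := by
    rw [Complex.star_def, Complex.conj_mul', hz, Complex.ofReal_one, one_pow]
  rw [conjTranspose_smul, smul_mul_assoc, smul_mul_smul_comm, star_mul_self, one_smul, h i]

theorem unique (h : Covers ℓ V R) (h' : Covers ℓ V R') : R = R' :=
  (isCliffordFamily_Γ ℓ).smul_injective ((covers_iff.mp h).symm.trans (covers_iff.mp h'))

theorem mem_orthogonalGroup (h : Covers ℓ V R) (hV : V ∈ unitaryGroup (QIdx ℓ) ℂ) :
    R ∈ orthogonalGroup (Site ℓ) ℝ := by
  refine (mem_orthogonalGroup_iff _ _).mpr ((isCliffordFamily_Γ ℓ).mul_transpose_eq_one ?_)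
  rw [← covers_iff.mp h]
  exact (isCliffordFamily_Γ ℓ).conj (mem_unitaryGroup_iff.mp hV) (mem_unitaryGroup_iff'.mp hV)

theorem conjTranspose (h : Covers ℓ V R) (hV : V ∈ unitaryGroup (QIdx ℓ) ℂ) :
    Covers ℓ Vᴴ Rᵀ := by
  have hVV : V * Vᴴ = 1 := mem_unitaryGroup_iff.mp hV
  have hRR : Rᵀ * R = 1 := (mem_orthogonalGroup_iff' _ _).mp (h.mem_orthogonalGroup hV)
  have conj_conj : Γ ℓ = R • fun i => V * Γ ℓ i * Vᴴ := by
    rw [← conj_smul_Γ, ← covers_iff.mp h]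
    funext i
    calc Γ ℓ i = V * Vᴴ * Γ ℓ i * (V * Vᴴ) := by rw [hVV, one_mul, mul_one]
      _ = V * (Vᴴ * Γ ℓ i * V) * Vᴴ := by simp only [mul_assoc]
  rw [covers_iff, conjTranspose_conjTranspose]
  conv_rhs => rw [conj_conj, ← mul_smul, hRR, one_smul]

end Covers

theorem covers_rot {a b : Site ℓ} (h : a ≠ b) (θ : ℝ) :
    Covers ℓ (rot ℓ a b θ) (givens a b (2 * θ)) := fun i => by
  simp only [Complex.coe_smul, sum_givens_smul h]
  split_ifs with ha hb
  · rw [conj_rot_Γ_of_mem h (.inl ha), ha, rot_eq h, mul_sub, mul_smul_comm, mul_smul_comm, mul_one,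
      ← mul_assoc, (isCliffordFamily_Γ ℓ).mul_self, one_mul]
  · rw [conj_rot_Γ_of_mem h (.inr hb), hb, rot_eq h, mul_sub, mul_smul_comm, mul_smul_comm, mul_one,
      (isCliffordFamily_Γ ℓ).mul_pair_of_mem h (.inr rfl), mul_assoc,
      (isCliffordFamily_Γ ℓ).mul_self, mul_one, smul_neg, sub_neg_eq_add, add_comm]
  · exact conj_rot_Γ_of_notMem h ha hb θ

theorem exists_covers_of_mem_spinGates (hV : V ∈ spinGates ℓ) :
    ∃ R ∈ specialOrthogonalGroup (Site ℓ) ℝ, Covers ℓ V R := by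
  induction hV using Submonoid.closure_induction with
  | mem V hV =>
    obtain ⟨a, b, h, θ, rfl⟩ := hV
    exact ⟨_, givens_mem_specialOrthogonalGroup h _, covers_rot h θ⟩
  | one => exact ⟨1, one_mem _, covers_one ℓ⟩
  | mul V V' _ _ h h' =>
    obtain ⟨R, hR, h⟩ := h
    obtain ⟨R', hR', h'⟩ := h'
    exact ⟨R * R', mul_mem hR hR', h.mul h'⟩

theorem spinorProd_mem_spinGates_and_covers (θ : Site ℓ → Site ℓ → ℝ) :
    spinorProd ℓ θ ∈ spinGates ℓ ∧ Covers ℓ (spinorProd ℓ θ)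
      (orderedPairProd (fun a b => givens a b (2 * θ a b)) (List.finRange (2 * ℓ + 1))) := by
  rw [spinorProd, prod_map_prod_filter_lt_eq_orderedPairProd _ (List.pairwise_lt_finRange _)]
  exact orderedPairProd_rel (r := fun V R => V ∈ spinGates ℓ ∧ Covers ℓ V R)
    ⟨one_mem _, covers_one ℓ⟩ (fun h h' => ⟨mul_mem h.1 h'.1, h.2.mul h'.2⟩)
    (List.nodup_finRange _) fun a b hab => ⟨rot_mem_spinGates hab _, covers_rot hab _⟩

theorem exists_covers_spinorProd (hR : R ∈ specialOrthogonalGroup (Site ℓ) ℝ) :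
    ∃ θ, Covers ℓ (spinorProd ℓ θ) R := by
  obtain ⟨θ, rfl⟩ := exists_eq_orderedPairProd_givens (List.nodup_finRange (2 * ℓ + 1)) hR
    fun i hi => (hi (List.mem_finRange i)).elim
  refine ⟨fun a b => θ a b / 2, ?_⟩
  simpa only [mul_div_cancel₀ _ (two_ne_zero (α := ℝ))] using
    (spinorProd_mem_spinGates_and_covers fun a b => θ a b / 2).2

open scoped Matrix.Norms.L2Operator in
theorem Covers.eq_smul (h : Covers ℓ V R) (h' : Covers ℓ V' R)
    (hV : V ∈ unitaryGroup (QIdx ℓ) ℂ) (hV' : V' ∈ unitaryGroup (QIdx ℓ) ℂ) :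
    ∃ z : ℂ, ‖z‖ = 1 ∧ V = z • V' := by
  have star_mul_V' : V'ᴴ * V' = 1 := mem_unitaryGroup_iff'.mp hV'
  have V_mul_star : V * Vᴴ = 1 := mem_unitaryGroup_iff.mp hV
  have V'_mul_star : V' * V'ᴴ = 1 := mem_unitaryGroup_iff.mp hV'
  obtain ⟨z, hz⟩ : ∃ z : ℂ, V * V'ᴴ = z • 1 := eq_smul_one_of_commute_Γ fun a => by
    calc Γ ℓ a * (V * V'ᴴ) = V * Vᴴ * Γ ℓ a * V * V'ᴴ := by
          rw [V_mul_star, one_mul, mul_assoc]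
      _ = V * (Vᴴ * Γ ℓ a * V) * V'ᴴ := by simp only [mul_assoc]
      _ = V * (V'ᴴ * Γ ℓ a * V') * V'ᴴ := by rw [h, h']
      _ = V * V'ᴴ * Γ ℓ a * (V' * V'ᴴ) := by simp only [mul_assoc]
      _ = V * V'ᴴ * Γ ℓ a := by rw [V'_mul_star, mul_one]
  have hVz : V = z • V' := by
    rw [← one_mul V', ← smul_mul_assoc, ← hz, mul_assoc, star_mul_V', mul_one]
  have norm_z := CStarRing.norm_of_mem_unitary (mul_mem hV (Unitary.star_mem hV'))
  rw [star_eq_conjTranspose, hz, norm_smul, norm_one, mul_one] at norm_z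
  exact ⟨z, norm_z, hVz⟩

end Covers

section Measurement

variable {ℓ N : ℕ}

theorem Covers.measBasis_eq {V : VOp ℓ} {R : Matrix (Site ℓ) (Site ℓ) ℝ} (h : Covers ℓ V R) :
    measBasis ℓ V = R.map (fun x : ℝ => (x : ℂ)) := by
  ext i j
  calc trace (Γ ℓ i * V * Γ ℓ j * Vᴴ) / 2 ^ ℓ
    _ = trace (Vᴴ * Γ ℓ i * V * Γ ℓ j) / 2 ^ ℓ := by
        rw [trace_mul_comm]; simp only [mul_assoc]
    _ = (∑ k, (R i k : ℂ) * if k = j then 2 ^ ℓ else 0) / 2 ^ ℓ := by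
        simp only [h i, Finset.sum_mul, trace_sum, smul_mul_assoc, trace_smul,
          (isCliffordFamily_Γ ℓ).trace_mul, card_qIdx, smul_eq_mul, Nat.cast_pow, Nat.cast_ofNat]
    _ = (R i j : ℂ) := by
        rw [Fintype.sum_eq_single j fun k hk => by rw [if_neg hk, mul_zero], if_pos rfl,
          mul_div_cancel_right₀ _ (pow_ne_zero ℓ two_ne_zero)]

theorem sum_measBasis_smul {V : VOp ℓ} (hV : V ∈ spinGates ℓ) (i : Site ℓ) :
    ∑ j, measBasis ℓ V i j • Γ ℓ j = Vᴴ * Γ ℓ i * V := by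
  obtain ⟨R, -, h⟩ := exists_covers_of_mem_spinGates hV
  rw [h.measBasis_eq, h i]
  rfl

theorem map_ofReal_mem_unitaryGroup {n : Type*} [Fintype n] [DecidableEq n] {R : Matrix n n ℝ}
    (hR : R ∈ orthogonalGroup n ℝ) : R.map (fun x : ℝ => (x : ℂ)) ∈ unitaryGroup n ℂ := by
  refine mem_unitaryGroup_iff.mpr ?_
  calc R.map Complex.ofRealHom * (R.map Complex.ofRealHom)ᴴ
    _ = R.map Complex.ofRealHom * Rᵀ.map Complex.ofRealHom := by
        congr 1
        ext i j
        exact Complex.conj_ofReal _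
    _ = (R * Rᵀ).map Complex.ofRealHom := (Matrix.map_mul (f := Complex.ofRealHom)).symm
    _ = 1 := by
        rw [(mem_orthogonalGroup_iff _ _).mp hR, Matrix.map_one _ (map_zero _) (map_one _)]

theorem measBasis_mem_unitaryGroup {V : VOp ℓ} (hV : V ∈ spinGates ℓ) :
    measBasis ℓ V ∈ unitaryGroup (Site ℓ) ℂ := by
  obtain ⟨R, hR, h⟩ := exists_covers_of_mem_spinGates hV
  exact h.measBasis_eq ▸ map_ofReal_mem_unitaryGroup (mem_specialOrthogonalGroup_iff.mp hR).1

theorem sum_prod_smul_list_prod {ι K A : Type*} [Fintype ι] [CommSemiring K] [Semiring A]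
    [Algebra K A] (w : Fin N → ι → K) (f : ι → A) :
    ∑ i : Fin N → ι, (∏ k, w k (i k)) • (List.ofFn fun k => f (i k)).prod =
      (List.ofFn fun k => ∑ j, w k j • f j).prod := by
  classical
  simpa only [MultilinearMap.map_smul_univ, MultilinearMap.mkPiAlgebraFin_apply] using
    ((MultilinearMap.mkPiAlgebraFin K N A).map_sum fun k j => w k j • f j).symm

theorem list_prod_ofFn_smul {K A : Type*} [CommSemiring K] [Semiring A] [Algebra K A]
    (r : K) (f : Fin N → A) :
    (List.ofFn fun k => r • f k).prod = r ^ N • (List.ofFn f).prod := by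
  simpa only [MultilinearMap.mkPiAlgebraFin_apply, Finset.prod_const, Finset.card_univ,
    Fintype.card_fin] using (MultilinearMap.mkPiAlgebraFin K N A).map_smul_univ (fun _ => r) f

theorem postState_eq_smul_prod (W : List (Site ℓ) → Matrix (Site ℓ) (Site ℓ) ℂ)
    (s : Fin N → Site ℓ) (L : QIdx ℓ → ℂ) :
    postState W s L =
      ((((Real.sqrt (2 * ℓ + 1))⁻¹ : ℝ) : ℂ) ^ N) •
        ((List.ofFn fun k => ∑ j, W (history s k) (s k) j • Γ ℓ j).prod *ᵥ L) := by
  simp only [postState, akltState, kraus, list_prod_ofFn_smul, ← smul_mulVec, ← sum_mulVec]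
  rw [← sum_prod_smul_list_prod, Finset.smul_sum]
  exact congrArg (· *ᵥ L) <| Finset.sum_congr rfl fun i _ => smul_comm _ _ _

theorem postState_measBasis {V : List (Site ℓ) → VOp ℓ} (hV : ∀ h, V h ∈ spinGates ℓ)
    (s : Fin N → Site ℓ) (L : QIdx ℓ → ℂ) :
    postState (fun h => measBasis ℓ (V h)) s L =
      ((((Real.sqrt (2 * ℓ + 1))⁻¹ : ℝ) : ℂ) ^ N) •
        ((List.ofFn fun k =>
          (V (history s k))ᴴ * Γ ℓ (s k) * V (history s k)).prod *ᵥ L) := by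
  simp only [postState_eq_smul_prod, sum_measBasis_smul (hV _)]

theorem normSq_smul (c : ℂ) (ψ : QIdx ℓ → ℂ) : normSq (c • ψ) = ‖c‖ ^ 2 * normSq ψ := by
  simp only [normSq, Pi.smul_apply, smul_eq_mul, norm_mul, mul_pow, Finset.mul_sum]

theorem ofReal_normSq (ψ : QIdx ℓ → ℂ) : (normSq ψ : ℂ) = star ψ ⬝ᵥ ψ := by
  simp [normSq, dotProduct, Complex.conj_mul']

theorem normSq_mulVec {U : VOp ℓ} (hU : U ∈ unitaryGroup (QIdx ℓ) ℂ) (ψ : QIdx ℓ → ℂ) :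
    normSq (U *ᵥ ψ) = normSq ψ := by
  have star_mul_self : Uᴴ * U = 1 := mem_unitaryGroup_iff'.mp hU
  rw [← Complex.ofReal_inj, ofReal_normSq, ofReal_normSq, star_mulVec, dotProduct_mulVec,
    vecMul_vecMul, star_mul_self, vecMul_one]

theorem outcomeProb_measBasis {V : List (Site ℓ) → VOp ℓ} (hV : ∀ h, V h ∈ spinGates ℓ)
    (s : Fin N → Site ℓ) {L : QIdx ℓ → ℂ} (hL : normSq L = 1) :
    outcomeProb (fun h => measBasis ℓ (V h)) s L = (1 / (2 * (ℓ : ℝ) + 1)) ^ N := by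
  have prod_mem : (List.ofFn fun k => (V (history s k))ᴴ * Γ ℓ (s k) * V (history s k)).prod ∈
      unitaryGroup (QIdx ℓ) ℂ := by
    refine list_prod_mem <| List.forall_mem_ofFn_iff.mpr fun k => ?_
    have hVk := spinGates_le_unitaryGroup ℓ (hV (history s k))
    exact mul_mem (mul_mem (Unitary.star_mem hVk) (Γ_mem_unitaryGroup _)) hVk
  rw [outcomeProb, postState_measBasis hV, normSq_smul, normSq_mulVec prod_mem, hL, mul_one,
    norm_pow, pow_right_comm, Complex.norm_real, Real.norm_eq_abs, sq_abs, inv_pow,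
    Real.sq_sqrt (by positivity), one_div]

end Measurement

section InducedGates

variable {ℓ : ℕ}

theorem inv_sqrt_ne_zero (ℓ : ℕ) : (((Real.sqrt (2 * ℓ + 1))⁻¹ : ℝ) : ℂ) ≠ 0 :=
  Complex.ofReal_ne_zero.mpr <| inv_ne_zero <| Real.sqrt_ne_zero'.mpr <| by positivity

theorem exists_covers_of_intertwines {U : VOp ℓ} (hU : U ∈ unitaryGroup (QIdx ℓ) ℂ)
    {S : Matrix (Site ℓ) (Site ℓ) ℂ} (hS : S.det = 1) (h : ∀ i, Γ ℓ i * U = U * (S • Γ ℓ) i) :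
    ∃ R ∈ specialOrthogonalGroup (Site ℓ) ℝ, Covers ℓ U R := by
  have conj_eq : (fun i => Uᴴ * Γ ℓ i * U) = S • Γ ℓ := funext fun i => by
    have star_mul_self : Uᴴ * U = 1 := mem_unitaryGroup_iff'.mp hU
    rw [mul_assoc, h, ← mul_assoc, star_mul_self, one_mul]
  have S_real : S.map star = S := (isCliffordFamily_Γ ℓ).smul_injective <| by
    change S.map star • Γ ℓ = S • Γ ℓ
    rw [← conj_eq]
    funext i
    calc (S.map star • Γ ℓ) i = ((S • Γ ℓ) i)ᴴ := by
          simp only [Module.smul_apply, conjTranspose_sum, conjTranspose_smul, conjTranspose_Γ,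
            map_apply]
      _ = (Uᴴ * Γ ℓ i * U)ᴴ := by rw [← conj_eq]
      _ = Uᴴ * Γ ℓ i * U := by
          rw [conjTranspose_mul, conjTranspose_mul, conjTranspose_conjTranspose, conjTranspose_Γ,
            mul_assoc]
  have map_re : (S.map Complex.re).map Complex.ofRealHom = S := by
    ext i j
    exact Complex.conj_eq_iff_re.mp (congrFun₂ S_real i j)
  have covers : Covers ℓ U (S.map Complex.re) := fun i => by
    rw [congrFun conj_eq i, ← map_re]
    rfl
  refine ⟨_, mem_specialOrthogonalGroup_iff.mpr ⟨covers.mem_orthogonalGroup hU, ?_⟩, covers⟩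
  rw [← Complex.ofReal_eq_one, ← hS, ← map_re]
  exact RingHom.map_det Complex.ofRealHom _

theorem isUnit_of_mem_of_isUnit_list_prod {n K : Type*} [Fintype n] [DecidableEq n] [CommRing K]
    {l : List (Matrix n n K)} (hl : IsUnit l.prod) {M : Matrix n n K} (hM : M ∈ l) : IsUnit M := by
  rw [isUnit_iff_isUnit_det, ← coe_detMonoidHom, map_list_prod, List.prod_isUnit_iff] at hl
  exact (isUnit_iff_isUnit_det M).mpr (hl _ (List.mem_map_of_mem hM))

theorem exists_covers_of_mem_inducedGates {U : unitaryGroup (QIdx ℓ) ℂ}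
    (hU : U ∈ inducedGates ℓ) : ∃ R ∈ specialOrthogonalGroup (Site ℓ) ℝ, Covers ℓ U R := by
  obtain ⟨N, W, s, c, -, hc, hpost⟩ := hU
  set l : List (Site ℓ → ℂ) := List.ofFn fun k => W (history s k) (s k) with hl
  obtain ⟨z, hz, prod_eq⟩ :
      ∃ z : ℂ, z ≠ 0 ∧ (l.map fun w => ∑ j, w j • Γ ℓ j).prod = z • (U : VOp ℓ) := by
    have hr := pow_ne_zero N (inv_sqrt_ne_zero ℓ)
    refine ⟨_, mul_ne_zero (inv_ne_zero hr) hc, ext_of_mulVec_single fun x => ?_⟩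
    rw [smul_mulVec, mul_smul, ← hpost, postState_eq_smul_prod, inv_smul_smul₀ hr, hl,
      List.map_ofFn]
    rfl
  have prod_isUnit : IsUnit (l.map fun w => ∑ j, w j • Γ ℓ j).prod := by
    rw [prod_eq]
    exact ((Unitary.toUnits U).isUnit).smul (Units.mk0 z hz)
  obtain ⟨S, hS, intertwines⟩ := (isCliffordFamily_Γ ℓ).exists_intertwines_list_prod
    fun w hw => isUnit_of_mem_of_isUnit_list_prod prod_isUnit (List.mem_map_of_mem hw)
  have det_S : S.det = 1 := by
    have : Even (Fintype.card (Site ℓ) + 1) := by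
      rw [Fintype.card_fin]
      exact ⟨ℓ + 1, by ring⟩
    rw [hS, this.neg_one_pow, one_pow]
  refine exists_covers_of_intertwines U.2 det_S fun i => smul_right_injective _ hz ?_
  simpa only [prod_eq, mul_smul_comm, smul_mul_assoc] using intertwines i

theorem exists_eq_prod_conj_Γ {V : VOp ℓ} (hV : V ∈ spinGates ℓ) :
    ∃ l : List (Site ℓ × spinGates ℓ),
      V = (l.map fun p => (p.2 : VOp ℓ)ᴴ * Γ ℓ p.1 * (p.2 : VOp ℓ)).prod := by
  induction hV using Submonoid.closure_induction with
  | mem V hV =>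
    obtain ⟨a, b, h, θ, rfl⟩ := hV
    refine ⟨[(a, 1), (a, ⟨rot ℓ a b (θ / 2), rot_mem_spinGates h _⟩)], ?_⟩
    simp only [List.map_cons, List.map_nil, List.prod_cons, List.prod_nil, mul_one,
      Submonoid.coe_one, conjTranspose_one, one_mul, conj_rot_Γ_of_mem h (.inl rfl),
      mul_div_cancel₀ θ two_ne_zero, ← mul_assoc, (isCliffordFamily_Γ ℓ).mul_self]
  | one => exact ⟨[], rfl⟩
  | mul V V' _ _ h h' =>
    obtain ⟨l, rfl⟩ := h
    obtain ⟨l', rfl⟩ := h'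
    exact ⟨l ++ l', by rw [List.map_append, List.prod_append]⟩

theorem history_injective {N : ℕ} (s : Fin N → Site ℓ) : Function.Injective (history s) := by
  intro k k' h
  have := congrArg List.length h
  simp only [history, List.length_drop, List.length_ofFn] at this
  lia

theorem mem_inducedGates_of_eq_smul {U : unitaryGroup (QIdx ℓ) ℂ} {V : VOp ℓ}
    (hV : V ∈ spinGates ℓ) {z : ℂ} (hz : ‖z‖ = 1) (hU : (U : VOp ℓ) = z • V) :
    U ∈ inducedGates ℓ := by
  have hz₀ : z ≠ 0 := norm_ne_zero_iff.mp (hz ▸ one_ne_zero)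
  obtain ⟨l, rfl⟩ := exists_eq_prod_conj_Γ hV
  let s : Fin l.length → Site ℓ := fun k => l[k].1
  let F : List (Site ℓ) → spinGates ℓ := Function.extend (history s) (fun k => l[k].2) 1
  have F_history (k : Fin l.length) : F (history s k) = l[k].2 :=
    (history_injective s).extend_apply _ _ k
  refine ⟨l.length, fun h => measBasis ℓ (F h), s,
    (((Real.sqrt (2 * ℓ + 1))⁻¹ : ℝ) : ℂ) ^ l.length * z⁻¹,
    fun h => measBasis_mem_unitaryGroup (F h).2,
    mul_ne_zero (pow_ne_zero _ (inv_sqrt_ne_zero ℓ)) (inv_ne_zero hz₀), fun L => ?_⟩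
  rw [postState_measBasis fun h => (F h).2, hU, smul_mulVec, mul_smul, inv_smul_smul₀ hz₀]
  simp only [F_history]
  congr 3
  exact List.ofFn_getElem_eq_map l fun p => (p.2 : VOp ℓ)ᴴ * Γ ℓ p.1 * (p.2 : VOp ℓ)

theorem Covers.exists_eq_smul_spinorProd {U : VOp ℓ} (hU : U ∈ unitaryGroup (QIdx ℓ) ℂ)
    {R : Matrix (Site ℓ) (Site ℓ) ℝ} (hR : R ∈ specialOrthogonalGroup (Site ℓ) ℝ)
    (h : Covers ℓ U R) :
    ∃ (z : ℂ) (θ : Site ℓ → Site ℓ → ℝ), ‖z‖ = 1 ∧ U = z • spinorProd ℓ θ := by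
  obtain ⟨θ, hθ⟩ := exists_covers_spinorProd hR
  obtain ⟨z, hz, hUz⟩ := h.eq_smul hθ hU
    (spinGates_le_unitaryGroup ℓ (spinorProd_mem_spinGates_and_covers θ).1)
  exact ⟨z, θ, hz, hUz⟩

variable (ℓ) in
/-- The group of the unitaries that cover a rotation. It equals `inducedGates ℓ`
(`coe_coveringGroup`), which is not obviously closed under products and inverses. -/
def coveringGroup : Subgroup (unitaryGroup (QIdx ℓ) ℂ) where
  carrier := {U | ∃ R ∈ specialOrthogonalGroup (Site ℓ) ℝ, Covers ℓ U R}
  one_mem' := ⟨1, one_mem _, covers_one ℓ⟩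
  mul_mem' := by
    rintro U U' ⟨R, hR, h⟩ ⟨R', hR', h'⟩
    exact ⟨R * R', mul_mem hR hR', h.mul h'⟩
  inv_mem' := by
    rintro U ⟨R, hR, h⟩
    exact ⟨Rᵀ, ((⟨R, hR⟩ : specialOrthogonalGroup (Site ℓ) ℝ)⁻¹).2, h.conjTranspose U.2⟩

variable (ℓ) in
/-- The double cover with its phases, `π : G → SO(2ℓ+1)`: the rotation covered by a unitary,
which is chosen among the witnesses in `coveringGroup` and is unique by `Covers.unique`. -/
noncomputable def coveredRotation :
    coveringGroup ℓ →* specialOrthogonalGroup (Site ℓ) ℝ where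
  toFun U := ⟨U.2.choose, U.2.choose_spec.1⟩
  map_one' := Subtype.ext <| (1 : coveringGroup ℓ).2.choose_spec.2.unique (covers_one ℓ)
  map_mul' U U' := Subtype.ext <|
    (U * U').2.choose_spec.2.unique (U.2.choose_spec.2.mul U'.2.choose_spec.2)

theorem covers_coveredRotation (U : coveringGroup ℓ) :
    Covers ℓ (U : unitaryGroup (QIdx ℓ) ℂ) (coveredRotation ℓ U) :=
  U.2.choose_spec.2

theorem coe_coveringGroup (ℓ : ℕ) :
    (coveringGroup ℓ : Set (unitaryGroup (QIdx ℓ) ℂ)) = inducedGates ℓ := by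
  refine Set.Subset.antisymm ?_ fun U => exists_covers_of_mem_inducedGates
  rintro U ⟨R, hR, h⟩
  obtain ⟨z, θ, hz, hU⟩ := h.exists_eq_smul_spinorProd U.2 hR
  exact mem_inducedGates_of_eq_smul (spinorProd_mem_spinGates_and_covers θ).1 hz hU

theorem exists_mem_coveringGroup {V : VOp ℓ} (hV : V ∈ spinGates ℓ) :
    ∃ U : coveringGroup ℓ, ((U : unitaryGroup (QIdx ℓ) ℂ) : VOp ℓ) = V :=
  ⟨⟨⟨V, spinGates_le_unitaryGroup ℓ hV⟩, exists_covers_of_mem_spinGates hV⟩, rfl⟩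

theorem exists_eq_spinorProd_coveredRotation_eq (R : specialOrthogonalGroup (Site ℓ) ℝ) :
    ∃ θ : Site ℓ → Site ℓ → ℝ, ∃ U : coveringGroup ℓ,
      ((U : unitaryGroup (QIdx ℓ) ℂ) : VOp ℓ) = spinorProd ℓ θ ∧ coveredRotation ℓ U = R := by
  obtain ⟨θ, hθ⟩ := exists_covers_spinorProd R.2
  obtain ⟨U, hU⟩ := exists_mem_coveringGroup (spinorProd_mem_spinGates_and_covers θ).1
  have hcov := covers_coveredRotation U
  rw [hU] at hcov
  exact ⟨θ, U, hU, Subtype.ext (hcov.unique hθ)⟩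

theorem coveredRotation_surjective (ℓ : ℕ) : Function.Surjective (coveredRotation ℓ) := fun R =>
  let ⟨_, U, _, hU⟩ := exists_eq_spinorProd_coveredRotation_eq R
  ⟨U, hU⟩

theorem coveredRotation_eq_one_iff (U : coveringGroup ℓ) :
    coveredRotation ℓ U = 1 ↔
      ∃ z : ℂ, ‖z‖ = 1 ∧ ((U : unitaryGroup (QIdx ℓ) ℂ) : VOp ℓ) = z • 1 := by
  have hcov := covers_coveredRotation U
  constructor
  · intro h
    rw [h] at hcov
    exact hcov.eq_smul (covers_one ℓ) U.1.2 (one_mem _)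
  · rintro ⟨z, hz, hU⟩
    rw [hU] at hcov
    exact Subtype.ext (hcov.unique ((covers_one ℓ).smul hz))

end InducedGates

section Uniqueness

variable {ℓ : ℕ} {A : Site ℓ → VOp ℓ} {b c : Site ℓ}

/-- The symmetry condition `∑_j R_{ij} A_j = V† A_i V` of an AKLT tensor, without the
normalization in `IsAKLTTensor`. -/
def IsEquivariant (A : Site ℓ → VOp ℓ) : Prop :=
  ∀ R ∈ specialOrthogonalGroup (Site ℓ) ℝ, ∀ V ∈ spinGates ℓ, Covers ℓ V R →
    ∀ i, ∑ j, (R i j : ℂ) • A j = Vᴴ * A i * V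

theorem isEquivariant_Γ (ℓ : ℕ) : IsEquivariant (Γ ℓ) :=
  fun _ _ _ _ h i => (h i).symm

namespace IsEquivariant

theorem const_smul (hA : IsEquivariant A) (z : ℂ) : IsEquivariant fun a => z • A a :=
  fun R hR V hV h i => by
    simp only [mul_smul_comm, smul_mul_assoc, ← hA R hR V hV h i, Finset.smul_sum, smul_comm z]

theorem conj_rot (hA : IsEquivariant A) (h : b ≠ c) (θ : ℝ) (i : Site ℓ) :
    (rot ℓ b c θ)ᴴ * A i * rot ℓ b c θ =
      if i = b then Real.cos (2 * θ) • A b - Real.sin (2 * θ) • A c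
      else if i = c then Real.sin (2 * θ) • A b + Real.cos (2 * θ) • A c else A i := by
  rw [← hA _ (givens_mem_specialOrthogonalGroup h _) _ (rot_mem_spinGates h θ) (covers_rot h θ)]
  simp only [Complex.coe_smul, sum_givens_smul h]

theorem conj_rot_pi_div_two (hA : IsEquivariant A) (h : b ≠ c) (i : Site ℓ) :
    (rot ℓ b c (Real.pi / 2))ᴴ * A i * rot ℓ b c (Real.pi / 2) =
      if i = b ∨ i = c then -A i else A i := by
  rw [hA.conj_rot h, mul_div_cancel₀ _ (two_ne_zero (α := ℝ)), Real.cos_pi, Real.sin_pi]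
  split_ifs <;> simp_all

theorem conj_rot_pi_div_four (hA : IsEquivariant A) (h : b ≠ c) :
    (rot ℓ b c (Real.pi / 4))ᴴ * A c * rot ℓ b c (Real.pi / 4) = A b := by
  rw [hA.conj_rot h, if_neg h.symm, if_pos rfl, show 2 * (Real.pi / 4) = Real.pi / 2 by ring,
    Real.sin_pi_div_two, Real.cos_pi_div_two, one_smul, zero_smul, add_zero]

/- `A i` and `Γ i` pick up the same sign under conjugation by `Γ b * Γ c`. -/
theorem commute_mul_Γ (hA : IsEquivariant A) (h : b ≠ c) (i : Site ℓ) :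
    Commute (A i * Γ ℓ i) (Γ ℓ b * Γ ℓ c) := by
  have rot_eq_neg : rot ℓ b c (Real.pi / 2) = -(Γ ℓ b * Γ ℓ c) := by simp [rot_eq h]
  have rot_mul_star : rot ℓ b c (Real.pi / 2) * (rot ℓ b c (Real.pi / 2))ᴴ = 1 :=
    mem_unitaryGroup_iff.mp (spinGates_le_unitaryGroup ℓ (rot_mem_spinGates h _))
  rw [← Commute.neg_right_iff, ← rot_eq_neg]
  have conj_A := hA.conj_rot_pi_div_two h i
  have conj_Γ := (isEquivariant_Γ ℓ).conj_rot_pi_div_two h i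
  generalize rot ℓ b c (Real.pi / 2) = V at rot_mul_star conj_A conj_Γ ⊢
  calc A i * Γ ℓ i * V = V * Vᴴ * A i * (V * Vᴴ) * Γ ℓ i * V := by
        rw [rot_mul_star, one_mul, mul_one]
    _ = V * ((Vᴴ * A i * V) * (Vᴴ * Γ ℓ i * V)) := by simp only [mul_assoc]
    _ = V * (A i * Γ ℓ i) := by
        rw [conj_A, conj_Γ]
        split_ifs
        · rw [neg_mul_neg]
        · rfl

theorem exists_apply_eq_smul_Γ (hA : IsEquivariant A) (i : Site ℓ) :
    ∃ z : ℂ, A i = z • Γ ℓ i := by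
  obtain ⟨z, hz⟩ := eq_smul_one_of_commute_Γ_mul_Γ fun _ _ h => hA.commute_mul_Γ h i
  exact ⟨z, by rw [← one_mul (Γ ℓ i), ← smul_mul_assoc, ← hz, mul_assoc,
    (isCliffordFamily_Γ ℓ).mul_self, mul_one]⟩

end IsEquivariant

theorem isEquivariant_iff : IsEquivariant A ↔ ∃ z : ℂ, ∀ a, A a = z • Γ ℓ a := by
  constructor
  · intro hA
    obtain ⟨z, hz⟩ := hA.exists_apply_eq_smul_Γ 0
    refine ⟨z, fun a => ?_⟩
    rcases eq_or_ne a 0 with rfl | ha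
    · exact hz
    · rw [← hA.conj_rot_pi_div_four ha, hz, mul_smul_comm, smul_mul_assoc,
        (isEquivariant_Γ ℓ).conj_rot_pi_div_four ha]
  · rintro ⟨z, hz⟩
    exact funext hz ▸ (isEquivariant_Γ ℓ).const_smul z

theorem sum_conjTranspose_smul_kraus_mul (ℓ : ℕ) (z : ℂ) :
    ∑ a, (z • kraus ℓ a)ᴴ * (z • kraus ℓ a) = ((‖z‖ ^ 2 : ℝ) : ℂ) • (1 : VOp ℓ) := by
  have summand (a : Site ℓ) : (z • kraus ℓ a)ᴴ * (z • kraus ℓ a) =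
      ((‖z‖ ^ 2 * (2 * ℓ + 1 : ℝ)⁻¹ : ℝ) : ℂ) • 1 := by
    rw [kraus, smul_smul, conjTranspose_smul, smul_mul_smul_comm, conjTranspose_Γ,
      (isCliffordFamily_Γ ℓ).mul_self, Complex.star_def, Complex.conj_mul', ← Complex.ofReal_pow,
      norm_mul, mul_pow, Complex.norm_real, norm_inv, inv_pow, Real.norm_eq_abs, sq_abs,
      Real.sq_sqrt (by positivity)]
  have card_ne : (2 * ℓ + 1 : ℂ) ≠ 0 := by exact_mod_cast (2 * ℓ).succ_ne_zero
  rw [Finset.sum_congr rfl fun a _ => summand a, Finset.sum_const, Finset.card_univ,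
    Fintype.card_fin, ← Nat.cast_smul_eq_nsmul ℂ, smul_smul]
  push_cast
  rw [mul_left_comm, mul_inv_cancel₀ card_ne, mul_one]

theorem isAKLTTensor_iff :
    IsAKLTTensor ℓ A ↔ ∃ z : ℂ, ‖z‖ = 1 ∧ ∀ a, A a = z • kraus ℓ a := by
  constructor
  · rintro ⟨normalized, equivariant⟩
    obtain ⟨w, hw⟩ := isEquivariant_iff.mp equivariant
    obtain ⟨z, rfl⟩ : ∃ z : ℂ, w = z * (((Real.sqrt (2 * ℓ + 1))⁻¹ : ℝ) : ℂ) :=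
      ⟨_, (div_mul_cancel₀ w (inv_sqrt_ne_zero ℓ)).symm⟩
    have hz (a : Site ℓ) : A a = z • kraus ℓ a := by rw [hw, kraus, mul_smul]
    simp only [hz, sum_conjTranspose_smul_kraus_mul] at normalized
    have norm_sq : ((‖z‖ ^ 2 : ℝ) : ℂ) = 1 :=
      smul_left_injective ℂ (one_ne_zero (α := VOp ℓ)) (normalized.trans (one_smul ℂ 1).symm)
    exact ⟨z, (pow_eq_one_iff_of_nonneg (norm_nonneg z) two_ne_zero).mp
      (Complex.ofReal_eq_one.mp norm_sq), hz⟩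
  · rintro ⟨z, hz, hA⟩
    obtain rfl : A = fun a => z • kraus ℓ a := funext hA
    refine ⟨?_, isEquivariant_iff.mpr ⟨_, fun a => by rw [kraus, smul_smul]⟩⟩
    rw [sum_conjTranspose_smul_kraus_mul, hz, one_pow, Complex.ofReal_one, one_smul]

end Uniqueness

section SuccessProbability

variable {ℓ : ℕ} {a b j : Site ℓ} {B G V : VOp ℓ} {ε φ : ℝ}

theorem exists_sign_byproduct_mul_rot (hB : B ∈ byproducts ℓ) (h : a ≠ b) :
    ∃ ε : ℝ, (ε = 1 ∨ ε = -1) ∧ ∀ φ, B * rot ℓ a b φ = rot ℓ a b (ε * φ) * B := by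
  induction hB using Submonoid.closure_induction with
  | mem B hB =>
    obtain ⟨j, rfl⟩ := hB
    by_cases hj : j = a ∨ j = b
    · exact ⟨-1, .inr rfl, fun φ => by rw [neg_one_mul, Γ_mul_rot_of_mem h hj]⟩
    · rw [not_or] at hj
      exact ⟨1, .inl rfl, fun φ => by rw [one_mul, Γ_mul_rot_of_notMem h hj.1 hj.2]⟩
  | one => exact ⟨1, .inl rfl, fun φ => by rw [one_mul, one_mul, mul_one]⟩
  | mul B C _ _ hB hC =>
    obtain ⟨ε, hε, hB⟩ := hB
    obtain ⟨ε', hε', hC⟩ := hC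
    refine ⟨ε * ε', ?_, fun φ => by rw [mul_assoc, hC, ← mul_assoc, hB, mul_assoc, mul_assoc]⟩
    rcases hε with rfl | rfl <;> simpa [neg_eq_iff_eq_neg, or_comm] using hε'

theorem rot_ne_smul_one (h : a ≠ b) (hφ : Real.sin φ ≠ 0) (z : ℂ) : rot ℓ a b φ ≠ z • 1 := by
  intro hz
  have rot_neg : rot ℓ a b (-φ) = rot ℓ a b φ := by
    rw [← mul_one (rot ℓ a b (-φ)), ← (isCliffordFamily_Γ ℓ).mul_self a, ← mul_assoc,
      ← Γ_mul_rot_of_mem h (.inl rfl), hz, mul_smul_comm, mul_one, smul_mul_assoc,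
      (isCliffordFamily_Γ ℓ).mul_self]
  have pair_ne_zero : Γ ℓ a * Γ ℓ b ≠ 0 := fun pair_eq_zero => by
    have pair_sq := (isCliffordFamily_Γ ℓ).pair_mul_self h
    rw [pair_eq_zero, mul_zero, zero_eq_neg] at pair_sq
    exact one_ne_zero pair_sq
  rw [rot_eq h, rot_eq h, Real.cos_neg, Real.sin_neg, sub_right_inj] at rot_neg
  exact hφ (neg_eq_self.mp (smul_left_injective ℝ pair_ne_zero rot_neg))

theorem performs_measBasis_iff {G₀ : VOp ℓ} (hV : V ∈ spinGates ℓ)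
    (hB : B ∈ unitaryGroup (QIdx ℓ) ℂ) (h : Vᴴ * Γ ℓ j * V * B = Γ ℓ j * B * G₀) :
    Performs ℓ (measBasis ℓ V) B G j ↔ ∃ c : ℂ, c ≠ 0 ∧ G₀ = c • G := by
  have hr := inv_sqrt_ne_zero ℓ
  set r : ℂ := (((Real.sqrt (2 * ℓ + 1))⁻¹ : ℝ) : ℂ)
  have postState_eq (ψ : QIdx ℓ → ℂ) :
      postState (fun _ => measBasis ℓ V) (fun _ : Fin 1 => j) (B *ᵥ ψ) =
        r • ((Γ ℓ j * B * G₀) *ᵥ ψ) := by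
    rw [postState_measBasis fun _ => hV, pow_one, List.ofFn_succ, List.ofFn_zero,
      List.prod_singleton, mulVec_mulVec, h]
  have cancel : (Γ ℓ j * B)ᴴ * (Γ ℓ j * B) = 1 :=
    mem_unitaryGroup_iff'.mp (mul_mem (Γ_mem_unitaryGroup j) hB)
  constructor
  · rintro ⟨c, hc, hperf⟩
    have smul_eq : r • (Γ ℓ j * B * G₀) = c • (Γ ℓ j * B * G) :=
      ext_of_mulVec_single fun x => by rw [smul_mulVec, smul_mulVec, ← hperf, postState_eq]
    refine ⟨r⁻¹ * c, mul_ne_zero (inv_ne_zero hr) hc, ?_⟩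
    calc G₀ = r⁻¹ • ((Γ ℓ j * B)ᴴ * (r • (Γ ℓ j * B * G₀))) := by
          rw [mul_smul_comm, inv_smul_smul₀ hr, ← mul_assoc, cancel, one_mul]
      _ = (r⁻¹ * c) • G := by
          rw [smul_eq, mul_smul_comm, ← mul_assoc, cancel, one_mul, mul_smul]
  · rintro ⟨c, hc, rfl⟩
    exact ⟨r * c, mul_ne_zero hr hc, fun ψ => by
      rw [postState_eq, mul_smul_comm, smul_mulVec, mul_smul]⟩

theorem performs_measBasis_rot_iff_of_mem (hB : B ∈ byproducts ℓ) (h : a ≠ b)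
    (hε : B * rot ℓ a b φ = rot ℓ a b (ε * φ) * B) (hj : j = a ∨ j = b) :
    Performs ℓ (measBasis ℓ (rot ℓ a b (ε * φ / 2))) B G j ↔
      ∃ c : ℂ, c ≠ 0 ∧ rot ℓ a b φ = c • G :=
  performs_measBasis_iff (rot_mem_spinGates h _) (byproducts_le_unitaryGroup ℓ hB) <| by
    rw [conj_rot_Γ_of_mem h hj, mul_div_cancel₀ _ two_ne_zero, mul_assoc, ← hε, mul_assoc]

theorem performs_measBasis_rot_iff_of_notMem (hB : B ∈ byproducts ℓ) (ha : j ≠ a) (hb : j ≠ b)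
    (h : a ≠ b) (θ : ℝ) :
    Performs ℓ (measBasis ℓ (rot ℓ a b θ)) B G j ↔ ∃ c : ℂ, c ≠ 0 ∧ 1 = c • G :=
  performs_measBasis_iff (rot_mem_spinGates h _) (byproducts_le_unitaryGroup ℓ hB) <| by
    rw [conj_rot_Γ_of_notMem h ha hb, mul_one]

theorem performs_rot_of_mem (hB : B ∈ byproducts ℓ) (h : a ≠ b)
    (hε : B * rot ℓ a b φ = rot ℓ a b (ε * φ) * B) (hj : j = a ∨ j = b) :
    Performs ℓ (measBasis ℓ (rot ℓ a b (ε * φ / 2))) B (rot ℓ a b φ) j :=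
  (performs_measBasis_rot_iff_of_mem hB h hε hj).mpr ⟨1, one_ne_zero, (one_smul ℂ _).symm⟩

theorem performs_one_of_notMem (hB : B ∈ byproducts ℓ) (h : a ≠ b) (ha : j ≠ a) (hb : j ≠ b)
    (θ : ℝ) : Performs ℓ (measBasis ℓ (rot ℓ a b θ)) B 1 j :=
  (performs_measBasis_rot_iff_of_notMem hB ha hb h θ).mpr ⟨1, one_ne_zero, (one_smul ℂ _).symm⟩

theorem performs_rot_iff (hB : B ∈ byproducts ℓ) (h : a ≠ b)
    (hε : B * rot ℓ a b φ = rot ℓ a b (ε * φ) * B) (hφ : Real.sin φ ≠ 0) :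
    Performs ℓ (measBasis ℓ (rot ℓ a b (ε * φ / 2))) B (rot ℓ a b φ) j ↔
      j ∈ ({a, b} : Finset (Site ℓ)) := by
  rw [Finset.mem_insert, Finset.mem_singleton]
  refine ⟨fun hperf => ?_, performs_rot_of_mem hB h hε⟩
  by_contra hj
  rw [not_or] at hj
  obtain ⟨c, hc, eq_smul⟩ := (performs_measBasis_rot_iff_of_notMem hB hj.1 hj.2 h _).mp hperf
  exact rot_ne_smul_one h hφ c⁻¹ ((eq_inv_smul_iff₀ hc).mpr eq_smul.symm)

theorem performs_one_iff (hB : B ∈ byproducts ℓ) (h : a ≠ b)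
    (hε : B * rot ℓ a b φ = rot ℓ a b (ε * φ) * B) (hφ : Real.sin φ ≠ 0) :
    Performs ℓ (measBasis ℓ (rot ℓ a b (ε * φ / 2))) B 1 j ↔
      j ∈ ({a, b} : Finset (Site ℓ))ᶜ := by
  rw [Finset.mem_compl, Finset.mem_insert, Finset.mem_singleton]
  refine ⟨fun hperf hj => ?_, fun hj => ?_⟩
  · obtain ⟨c, -, eq_smul⟩ := (performs_measBasis_rot_iff_of_mem hB h hε hj).mp hperf
    exact rot_ne_smul_one h hφ c eq_smul
  · rw [not_or] at hj
    exact performs_one_of_notMem hB h hj.1 hj.2 _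

theorem performProb_measBasis (hV : V ∈ spinGates ℓ) {S : Finset (Site ℓ)}
    (hS : ∀ j, Performs ℓ (measBasis ℓ V) B G j ↔ j ∈ S) {χ : QIdx ℓ → ℂ} (hχ : normSq χ = 1) :
    performProb ℓ (measBasis ℓ V) B G χ = S.card / (2 * (ℓ : ℝ) + 1) := by
  simp only [performProb, hS, Finset.filter_univ_mem, outcomeProb_measBasis (fun _ => hV) _ hχ,
    Finset.sum_const, nsmul_eq_mul, pow_one, mul_one_div]

theorem performProb_rot (hB : B ∈ byproducts ℓ) (h : a ≠ b)
    (hε : B * rot ℓ a b φ = rot ℓ a b (ε * φ) * B) (hφ : Real.sin φ ≠ 0) {χ : QIdx ℓ → ℂ}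
    (hχ : normSq χ = 1) :
    performProb ℓ (measBasis ℓ (rot ℓ a b (ε * φ / 2))) B (rot ℓ a b φ) χ =
      2 / (2 * (ℓ : ℝ) + 1) := by
  rw [performProb_measBasis (rot_mem_spinGates h _) (fun _ => performs_rot_iff hB h hε hφ) hχ,
    Finset.card_pair h, Nat.cast_ofNat]

theorem performProb_one (hB : B ∈ byproducts ℓ) (h : a ≠ b)
    (hε : B * rot ℓ a b φ = rot ℓ a b (ε * φ) * B) (hφ : Real.sin φ ≠ 0) {χ : QIdx ℓ → ℂ}
    (hχ : normSq χ = 1) :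
    performProb ℓ (measBasis ℓ (rot ℓ a b (ε * φ / 2))) B 1 χ = 1 - 2 / (2 * (ℓ : ℝ) + 1) := by
  have card_compl : (({a, b}ᶜ : Finset (Site ℓ)).card : ℝ) = 2 * (ℓ : ℝ) + 1 - 2 := by
    have card_add := Finset.card_add_card_compl ({a, b} : Finset (Site ℓ))
    rw [Finset.card_pair h, Fintype.card_fin] at card_add
    rw [eq_sub_iff_add_eq']
    exact_mod_cast card_add
  rw [performProb_measBasis (rot_mem_spinGates h _) (fun _ => performs_one_iff hB h hε hφ) hχ,
    card_compl, sub_div, div_self (by positivity)]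

end SuccessProbability

end SOAKLT

theorem proposition4 (ℓ : ℕ) (hℓ : 1 ≤ ℓ) :
    -- the state: the Clifford tensor is, up to a phase, the only AKLT tensor
    (∀ A : Site ℓ → VOp ℓ, IsAKLTTensor ℓ A ↔
      ∃ z : ℂ, ‖z‖ = 1 ∧ ∀ a, A a = z • kraus ℓ a) ∧
    -- the byproducts are tensor products of Pauli operators
    (∀ a, ∃ p : Fin ℓ → Fin 4, Γ ℓ a = pauliString ℓ p) ∧
    (∀ B ∈ byproducts ℓ, ∃ (z : ℂ) (p : Fin ℓ → Fin 4), z ^ 4 = 1 ∧ B = z • pauliString ℓ p) ∧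
    -- the gates induced by on-site measurements form `SO(2ℓ+1)` (modulo global phases)
    (∃ (G : Subgroup (Matrix.unitaryGroup (QIdx ℓ) ℂ))
        (π : G →* Matrix.specialOrthogonalGroup (Site ℓ) ℝ),
      (G : Set (Matrix.unitaryGroup (QIdx ℓ) ℂ)) = inducedGates ℓ ∧
      (∀ U : G, Covers ℓ (U : Matrix.unitaryGroup (QIdx ℓ) ℂ) (π U)) ∧
      Function.Surjective π ∧
      (∀ U : G, π U = 1 ↔
        ∃ z : ℂ, ‖z‖ = 1 ∧ ((U : Matrix.unitaryGroup (QIdx ℓ) ℂ) : VOp ℓ) = z • 1) ∧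
      -- spinor form of the gates
      (∀ V ∈ spinGates ℓ, ∃ U : G, ((U : Matrix.unitaryGroup (QIdx ℓ) ℂ) : VOp ℓ) = V) ∧
      (∀ R, ∃ θ : Site ℓ → Site ℓ → ℝ, ∃ U : G,
        ((U : Matrix.unitaryGroup (QIdx ℓ) ℂ) : VOp ℓ) = spinorProd ℓ θ ∧ π U = R) ∧
      (∀ U : G, ∃ (z : ℂ) (θ : Site ℓ → Site ℓ → ℝ), ‖z‖ = 1 ∧
        ((U : Matrix.unitaryGroup (QIdx ℓ) ℂ) : VOp ℓ) = z • spinorProd ℓ θ)) ∧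
    -- the measurement bases are given by rotations
    (∀ V ∈ spinGates ℓ, ∃ R ∈ Matrix.specialOrthogonalGroup (Site ℓ) ℝ,
      Covers ℓ V R ∧ measBasis ℓ V = R.map (fun x : ℝ => (x : ℂ))) ∧
    -- measuring in these bases induces the operators `V† Γ^j V`, all outcomes equally likely
    (∀ (N : ℕ) (V : List (Site ℓ) → VOp ℓ), (∀ h, V h ∈ spinGates ℓ) →
      ∀ (s : Fin N → Site ℓ) (L : QIdx ℓ → ℂ),
        postState (fun h => measBasis ℓ (V h)) s L =
          ((((Real.sqrt (2 * ℓ + 1))⁻¹ : ℝ) : ℂ) ^ N) •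
            ((List.ofFn fun k =>
              (V (history s k))ᴴ * Γ ℓ (s k) * V (history s k)).prod *ᵥ L) ∧
        (normSq L = 1 →
          outcomeProb (fun h => measBasis ℓ (V h)) s L = (1 / (2 * (ℓ : ℝ) + 1)) ^ N)) ∧
    -- each gate `exp(-iφ Γ^{ab})` is performed with probability `2/(2ℓ+1)`, whatever byproduct
    -- has accumulated; otherwise the identity is performed, up to a byproduct
    (∀ B ∈ byproducts ℓ, ∀ a b : Site ℓ, a ≠ b → ∃ ε : ℝ, (ε = 1 ∨ ε = -1) ∧
      ∀ φ : ℝ,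
        B * rot ℓ a b φ = rot ℓ a b (ε * φ) * B ∧
        (∀ j, j = a ∨ j = b →
          Performs ℓ (measBasis ℓ (rot ℓ a b (ε * φ / 2))) B (rot ℓ a b φ) j) ∧
        (∀ j, j ≠ a → j ≠ b →
          Performs ℓ (measBasis ℓ (rot ℓ a b (ε * φ / 2))) B 1 j) ∧
        (Real.sin φ ≠ 0 → ∀ χ : QIdx ℓ → ℂ, normSq χ = 1 →
          performProb ℓ (measBasis ℓ (rot ℓ a b (ε * φ / 2))) B (rot ℓ a b φ) χ
            = 2 / (2 * (ℓ : ℝ) + 1) ∧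
          performProb ℓ (measBasis ℓ (rot ℓ a b (ε * φ / 2))) B 1 χ
            = 1 - 2 / (2 * (ℓ : ℝ) + 1))) := by
  refine ⟨fun _ => isAKLTTensor_iff, exists_Γ_eq_pauliString,
    fun _ hB => byproducts_le_pauliGroup hB,
    ⟨coveringGroup ℓ, coveredRotation ℓ, coe_coveringGroup ℓ, covers_coveredRotation,
      coveredRotation_surjective ℓ, coveredRotation_eq_one_iff,
      fun _ hV => exists_mem_coveringGroup hV, exists_eq_spinorProd_coveredRotation_eq,
      fun U => (covers_coveredRotation U).exists_eq_smul_spinorProd U.1.2 (coveredRotation ℓ U).2⟩,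
    fun V hV => ?_,
    fun N V hV s L => ⟨postState_measBasis hV s L, outcomeProb_measBasis hV s⟩,
    fun B hB a b hab => ?_⟩
  · obtain ⟨R, hR, h⟩ := exists_covers_of_mem_spinGates hV
    exact ⟨R, hR, h, h.measBasis_eq⟩
  · obtain ⟨ε, hε, commutes⟩ := exists_sign_byproduct_mul_rot hB hab
    exact ⟨ε, hε, fun φ => ⟨commutes φ,
      fun j hj => performs_rot_of_mem hB hab (commutes φ) hj,
      fun j ha hb => performs_one_of_notMem hB hab ha hb _,
      fun hφ χ hχ => ⟨performProb_rot hB hab (commutes φ) hφ hχ,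
        performProb_one hB hab (commutes φ) hφ hχ⟩⟩⟩
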